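/- Let $k$ be a commutative unital ring, let $\delta\in k$ and let $n\geqslant 1$. A partition $n$-diagram is a set partition of the $2n$ vertices $\{1,\dots,n,\overline{1},\dots,\overline{n}\}$ (left-hand and right-hand columns); its blocks are called components. Let $P_n(\delta)$ be the partition algebra: the $k$-algebra that is free as a $k$-module on the partition $n$-diagrams, with product $d_1d_2=\delta^{\alpha}d_3$, where $d_2$ is placed to the right of $d_1$ and the right-hand column of $d_1$ is identified with the left-hand column of $d_2$, $\alpha$ is the number of connected components of the resulting three-column diagram lying entirely in the middle column, and two outer vertices lie in the same component of $d_3$ if and only if they are connected in the three-column diagram. Let $\varepsilon\colon P_n(\delta)\to k$ be the augmentation sending every diagram with exactly $n$ components meeting both columns (a permutation diagram) to $1$ and every other diagram to $0$, and let $\mathbb{1}$ be the trivial right $P_n(\delta)$-module: a copy of $k$ on which $P_n(\delta)$ acts via $\varepsilon$. Let $\Sigma_n$ be the symmetric group, acting trivially on $\mathbb{1}=k$, and regard $k[\Sigma_n]$ as the subalgebra of $P_n(\delta)$ spanned by the permutation diagrams. Then for every integer $q$ with $0\leqslant q\leqslant n-1$ there is a natural isomorphism of $k$-modules \[\mathrm{Ext}^q_{P_n(\delta)}(\mathbb{1},\mathbb{1})\;\cong\;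 H^q(\Sigma_n,\mathbb{1}),\] where $\mathrm{Ext}$ is taken in the category of right $P_n(\delta)$-modules. Here natural means that the isomorphism is the canonical one: composed with the standard identification $H^q(\Sigma_n,\mathbb{1})\cong \mathrm{Ext}^q_{k[\Sigma_n]}(\mathbb{1},\mathbb{1})$ (given on inhomogeneous cocycles by the bar resolution), it is the restriction map $\mathrm{Ext}^q_{P_n(\delta)}(\mathbb{1},\mathbb{1})\to \mathrm{Ext}^q_{k[\Sigma_n]}(\mathbb{1},\mathbb{1})$ along the inclusion $k[\Sigma_n]\subset P_n(\delta)$. -/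

import Mathlib

universe u

/-- Partition `n`-diagrams up to equivalence, that is, set partitions (given as equivalence
relations) of the `2n` vertices.  `Sum.inl i` is the `i`-th vertex of the left-hand column and
`Sum.inr i` is the `i`-th vertex of the right-hand column; the connected components of the diagram
are the classes of the equivalence relation. -/
abbrev PartitionDiagram (n : ℕ) : Type := Setoid (Fin n ⊕ Fin n)

namespace PartitionDiagram

section Generalities

variable {X Y Z W : Type}

/-- The number of connected components (equivalence classes) contained in a set of vertices. -/
noncomputable def numComponentsIn (r : Setoid X) (S : Set X) : ℕ :=
  {C : Set X | C ∈ r.classes ∧ C ⊆ S}.ncard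

theorem map_le_iff (f : Y → X) (r : Setoid Y) (t : Setoid X) :
    r.map f ≤ t ↔ r ≤ t.comap f := by
  constructor
  · intro h a b hab
    exact h (Relation.EqvGen.rel _ _ ⟨a, b, hab, rfl, rfl⟩)
  · intro h
    refine Setoid.eqvGen_le ?_
    rintro _ _ ⟨a, b, hab, rfl, rfl⟩
    exact h hab

theorem map_gc (f : Y → X) :
    GaloisConnection (fun r : Setoid Y => r.map f) (fun t : Setoid X => t.comap f) :=
  fun r t => map_le_iff f r t

theorem map_sup' (f : Y → X) (r s : Setoid Y) : (r ⊔ s).map f = r.map f ⊔ s.map f :=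
  (map_gc f).l_sup

theorem map_map' (f : Y → X) (g : Z → Y) (r : Setoid Z) :
    (r.map g).map f = r.map (f ∘ g) := by
  refine le_antisymm ?_ ?_
  · rw [map_le_iff, map_le_iff, ← Setoid.comap_comp, ← map_le_iff]
  · rw [map_le_iff, Setoid.comap_comp, ← map_le_iff, ← map_le_iff]

theorem map_iff {f : Y → X} (hf : f.Injective) (r : Setoid Y) {x y : X} :
    r.map f x y ↔ x = y ∨ ∃ a b, r a b ∧ f a = x ∧ f b = y := by
  have h := Setoid.coe_map_of_ker_le r f (by
    intro a b hab
    rw [hf hab])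
  have h2 : r.map f x y ↔ (Relation.Map r f f ⊔ (· = ·)) x y := by rw [← h]
  rw [h2]
  simp only [Pi.sup_apply, sup_Prop_eq, Relation.Map]
  exact or_comm

/-- Tracing out: restricting a join along `g`, when one of the relations comes from `g`. -/
theorem comap_sup_map (g : Z → X) (r : Setoid X) (s : Setoid Z) :
    (r ⊔ s.map g).comap g = r.comap g ⊔ s := by
  refine le_antisymm ?_ (sup_le (fun a b h => (le_sup_left : r ≤ r ⊔ s.map g) h) ?_)
  · let t : Setoid X :=
      { r := fun x y => r x y ∨ ∃ a b, r x (g a) ∧ (r.comap g ⊔ s) a b ∧ r (g b) y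
        iseqv :=
          { refl := fun x => Or.inl (r.refl' x)
            symm := by
              rintro x y (h | ⟨a, b, h1, h2, h3⟩)
              · exact Or.inl (r.symm' h)
              · exact Or.inr ⟨b, a, r.symm' h3, (r.comap g ⊔ s).symm' h2, r.symm' h1⟩
            trans := by
              rintro x y z (h | ⟨a, b, h1, h2, h3⟩) (h' | ⟨a', b', h1', h2', h3'⟩)
              · exact Or.inl (r.trans' h h')
              · exact Or.inr ⟨a', b', r.trans' h h1', h2', h3'⟩
              · exact Or.inr ⟨a, b, h1, h2, r.trans' h3 h'⟩
              · refine Or.inr ⟨a, b', h1, (r.comap g ⊔ s).trans' h2 ?_, h3'⟩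
                refine (r.comap g ⊔ s).trans' ?_ h2'
                exact (le_sup_left : r.comap g ≤ r.comap g ⊔ s) (r.trans' h3 h1') } }
    have h1 : r ⊔ s.map g ≤ t := by
      refine sup_le (fun x y h => Or.inl h) ?_
      rw [map_le_iff]
      intro a b h
      exact Or.inr ⟨a, b, r.refl' _, (le_sup_right : s ≤ r.comap g ⊔ s) h, r.refl' _⟩
    intro a b h
    rcases h1 h with h | ⟨a', b', h1, h2, h3⟩
    · exact (le_sup_left : r.comap g ≤ r.comap g ⊔ s) h
    · refine (r.comap g ⊔ s).trans' ?_ ((r.comap g ⊔ s).trans' h2 ?_)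
      · exact (le_sup_left : r.comap g ≤ r.comap g ⊔ s) h1
      · exact (le_sup_left : r.comap g ≤ r.comap g ⊔ s) h3
  · rw [← map_le_iff]
    exact le_sup_right

/-- Base change for a pullback square of injections. -/
theorem comap_map_square {f : Y → X} {g : Z → X} {b : W → Y} {a : W → Z}
    (hf : f.Injective) (hg : g.Injective) (hsq : ∀ w, f (b w) = g (a w))
    (hpb : ∀ y z, f y = g z → ∃ w, b w = y) (r : Setoid Y) :
    (r.map f).comap g = (r.comap b).map a := by
  have hpb' : ∀ y z, f y = g z → ∃ w, b w = y ∧ a w = z := by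
    intro y z h
    obtain ⟨w, rfl⟩ := hpb y z h
    exact ⟨w, rfl, hg (by rw [← hsq, h])⟩
  refine le_antisymm ?_ ?_
  · intro x y h
    rw [Setoid.comap_rel, map_iff hf] at h
    rcases h with h | ⟨p, q, hpq, hp, hq⟩
    · rw [hg h]
    · obtain ⟨w, rfl, rfl⟩ := hpb' _ _ hp
      obtain ⟨w', rfl, rfl⟩ := hpb' _ _ hq
      exact Relation.EqvGen.rel _ _ ⟨w, w', hpq, rfl, rfl⟩
  · rw [map_le_iff]
    intro w w' h
    rw [Setoid.comap_rel, Setoid.comap_rel, ← hsq, ← hsq]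
    exact Relation.EqvGen.rel _ _ ⟨_, _, h, rfl, rfl⟩

theorem mem_classes_iff (r : Setoid X) (C : Set X) :
    C ∈ r.classes ↔ ∃ x, C = {y | r y x} := Iff.rfl

/-- Counting the components of a join of two pieces glued along a common set of vertices. -/
theorem numComponentsIn_glue [Finite X] {f : Y → X} {g : Z → X}
    (hf : f.Injective) (hg : g.Injective) (A : Set Y) (B : Set Z)
    (hA : ∀ y, y ∈ A ↔ f y ∉ Set.range g) (hcov : ∀ x, x ∈ Set.range f ∨ x ∈ Set.range g)
    (r : Setoid Y) (s : Setoid Z) :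
    numComponentsIn (r.map f ⊔ s.map g) (f '' A ∪ g '' B) =
      numComponentsIn r A + numComponentsIn ((r.map f ⊔ s.map g).comap g) B := by
  set T : Setoid X := r.map f ⊔ s.map g with hT
  have hrT : ∀ {y y'}, r y y' → T (f y) (f y') := fun {y y'} h =>
    (le_sup_left : r.map f ≤ T) (Relation.EqvGen.rel _ _ ⟨_, _, h, rfl, rfl⟩)
  -- classes of `r` inside `A` are classes of `T`
  have key : ∀ y, {y' | r y' y} ⊆ A → f '' {y' | r y' y} = {x | T x (f y)} := by
    intro y hy
    apply Set.Subset.antisymm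
    · rintro _ ⟨y', h, rfl⟩
      exact hrT h
    · have hle : T ≤ Setoid.ker (fun x => x ∈ f '' {y' | r y' y}) := by
        refine sup_le ?_ ?_
        · rw [map_le_iff]
          intro p q hpq
          simp only [Setoid.comap_rel, Setoid.ker_def, eq_iff_iff, hf.mem_set_image,
            Set.mem_ofPred_eq]
          exact ⟨fun h => r.trans' (r.symm' hpq) h, fun h => r.trans' hpq h⟩
        · rw [map_le_iff]
          intro p q _
          have h0 : ∀ p, g p ∉ f '' {y' | r y' y} := by
            rintro p ⟨y', h, h'⟩
            exact (hA y').1 (hy h) ⟨p, h'.symm⟩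
          simp only [Setoid.comap_rel, Setoid.ker_def, h0]
      intro x hx
      have := hle hx
      simp only [Setoid.ker_def, eq_iff_iff] at this
      exact this.2 ⟨y, r.refl' y, rfl⟩
  have hsplit : {C : Set X | C ∈ T.classes ∧ C ⊆ f '' A ∪ g '' B} =
      {C : Set X | C ∈ T.classes ∧ C ⊆ f '' A} ∪
      {C : Set X | C ∈ T.classes ∧ C ⊆ f '' A ∪ g '' B ∧ ∃ z, g z ∈ C} := by
    ext C
    simp only [Set.mem_ofPred_eq, Set.mem_union]
    constructor
    · rintro ⟨h1, h2⟩
      by_cases h : ∃ z, g z ∈ C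
      · exact Or.inr ⟨h1, h2, h⟩
      · refine Or.inl ⟨h1, fun x hx => (h2 hx).resolve_right ?_⟩
        rintro ⟨z, _, rfl⟩
        exact h ⟨z, hx⟩
    · rintro (⟨h1, h2⟩ | ⟨h1, h2, _⟩)
      · exact ⟨h1, h2.trans Set.subset_union_left⟩
      · exact ⟨h1, h2⟩
  have hfirst : {C : Set X | C ∈ T.classes ∧ C ⊆ f '' A} =
      (fun D => f '' D) '' {D : Set Y | D ∈ r.classes ∧ D ⊆ A} := by
    ext C
    simp only [Set.mem_ofPred_eq, Set.mem_image]
    constructor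
    · rintro ⟨⟨x, rfl⟩, h2⟩
      obtain ⟨y, hy, rfl⟩ := h2 (T.refl' x)
      have hsub : {y' | r y' y} ⊆ A := by
        intro y' hy'
        exact (hf.mem_set_image).1 (h2 (hrT hy'))
      exact ⟨_, ⟨⟨y, rfl⟩, hsub⟩, key y hsub⟩
    · rintro ⟨_, ⟨⟨y, rfl⟩, hsub⟩, rfl⟩
      exact ⟨⟨f y, key y hsub⟩, Set.image_mono hsub⟩
  have hsecond : {D : Set Z | D ∈ (T.comap g).classes ∧ D ⊆ B} =
      (fun C => g ⁻¹' C) ''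
        {C : Set X | C ∈ T.classes ∧ C ⊆ f '' A ∪ g '' B ∧ ∃ z, g z ∈ C} := by
    ext D
    simp only [Set.mem_ofPred_eq, Set.mem_image]
    constructor
    · rintro ⟨⟨z, rfl⟩, h2⟩
      refine ⟨{x | T x (g z)}, ⟨⟨g z, rfl⟩, ?_, z, T.refl' _⟩, rfl⟩
      intro x hx
      by_cases hxg : x ∈ Set.range g
      · obtain ⟨z', rfl⟩ := hxg
        exact Or.inr ⟨z', h2 hx, rfl⟩
      · obtain ⟨y, rfl⟩ := (hcov x).resolve_right hxg
        exact Or.inl ⟨y, (hA y).2 hxg, rfl⟩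
    · rintro ⟨_, ⟨⟨x, rfl⟩, h2, z, hz⟩, rfl⟩
      refine ⟨⟨z, ?_⟩, ?_⟩
      · ext z'
        exact ⟨fun h => T.trans' h (T.symm' hz), fun h => T.trans' h hz⟩
      · intro z' hz'
        rcases h2 hz' with ⟨y, hy, hyz⟩ | ⟨z'', hz'', h⟩
        · exact absurd ⟨z', hyz.symm⟩ ((hA y).1 hy)
        · rwa [← hg h]
  have hinj : Set.InjOn (fun C : Set X => g ⁻¹' C)
      {C : Set X | C ∈ T.classes ∧ C ⊆ f '' A ∪ g '' B ∧ ∃ z, g z ∈ C} := by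
    rintro C ⟨hC, _, z, hz⟩ C' ⟨hC', _, _⟩ h
    have hz' : g z ∈ C' := by
      have h' : g ⁻¹' C = g ⁻¹' C' := h
      have h'' : z ∈ g ⁻¹' C' := by
        rw [← h']
        exact hz
      exact h''
    exact Setoid.eq_of_mem_classes hC hz hC' hz'
  unfold numComponentsIn
  rw [hsplit, Set.ncard_union_eq ?_ (Set.toFinite _) (Set.toFinite _), hfirst,
    Set.ncard_image_of_injective _ hf.image_injective, hsecond, hinj.ncard_image]
  rw [Set.disjoint_left]
  rintro C ⟨_, h2⟩ ⟨_, _, z, hz⟩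
  obtain ⟨y, hy, hyz⟩ := h2 hz
  exact (hA y).1 hy ⟨z, hyz.symm⟩

end Generalities

section Composition

variable {n : ℕ}

/-- In the three-column graph, the left-hand diagram occupies the left and middle columns. -/
def leftMiddle : Fin n ⊕ Fin n → Fin n ⊕ Fin n ⊕ Fin n := Sum.map id Sum.inl

/-- In the three-column graph, the right-hand diagram occupies the middle and right columns. -/
def middleRight : Fin n ⊕ Fin n → Fin n ⊕ Fin n ⊕ Fin n := Sum.inr

/-- The outer columns of the three-column graph. -/
def leftRight : Fin n ⊕ Fin n → Fin n ⊕ Fin n ⊕ Fin n := Sum.map id Sum.inr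

/-- The middle column of the three-column graph. -/
def middleColumn (n : ℕ) : Set (Fin n ⊕ Fin n ⊕ Fin n) :=
  Set.range fun i => Sum.inr (Sum.inl i)

/-- The three-column diagram `d₁ * d₂`, obtained by placing `d₂` to the right of `d₁` and
identifying the right-hand column of `d₁` with the left-hand column of `d₂`
(as the equivalence relation of lying in the same connected component). -/
@[reducible] def stack (d₁ d₂ : PartitionDiagram n) : Setoid (Fin n ⊕ Fin n ⊕ Fin n) :=
  d₁.map leftMiddle ⊔ d₂.map middleRight

/-- The number `α` of components of the three-column diagram lying entirely in the middle column. -/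
noncomputable def loops (d₁ d₂ : PartitionDiagram n) : ℕ :=
  numComponentsIn (stack d₁ d₂) (middleColumn n)

/-- The underlying diagram `d₃` of the product: two outer vertices are connected if they are
connected by a path in the three-column diagram. -/
@[reducible] def comp (d₁ d₂ : PartitionDiagram n) : PartitionDiagram n :=
  (stack d₁ d₂).comap leftRight

theorem assoc_aux (d₁ d₂ d₃ : PartitionDiagram n) :
    comp (comp d₁ d₂) d₃ = comp d₁ (comp d₂ d₃) ∧
      loops d₁ d₂ + loops (comp d₁ d₂) d₃ = loops d₂ d₃ + loops d₁ (comp d₂ d₃) := by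
  let e123 : Fin n ⊕ Fin n ⊕ Fin n → Fin n ⊕ Fin n ⊕ Fin n ⊕ Fin n :=
    Sum.map id (Sum.map id Sum.inl)
  let e134 : Fin n ⊕ Fin n ⊕ Fin n → Fin n ⊕ Fin n ⊕ Fin n ⊕ Fin n := Sum.map id Sum.inr
  let e124 : Fin n ⊕ Fin n ⊕ Fin n → Fin n ⊕ Fin n ⊕ Fin n ⊕ Fin n :=
    Sum.map id (Sum.map id Sum.inr)
  let e234 : Fin n ⊕ Fin n ⊕ Fin n → Fin n ⊕ Fin n ⊕ Fin n ⊕ Fin n := Sum.inr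
  have i123 : e123.Injective :=
    Function.injective_id.sumMap (Function.injective_id.sumMap Sum.inl_injective)
  have i134 : e134.Injective := Function.injective_id.sumMap Sum.inr_injective
  have i124 : e124.Injective :=
    Function.injective_id.sumMap (Function.injective_id.sumMap Sum.inr_injective)
  have i234 : e234.Injective := Sum.inr_injective
  have hTT : (stack d₁ d₂).map e123 ⊔ (d₃.map middleRight).map e134 =
      (stack d₂ d₃).map e234 ⊔ (d₁.map leftMiddle).map e124 := by
    have h1 : (e123 ∘ leftMiddle : Fin n ⊕ Fin n → _) = e124 ∘ leftMiddle := by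
      ext (i | i) <;> rfl
    have h2 : (e123 ∘ middleRight : Fin n ⊕ Fin n → _) = e234 ∘ leftMiddle := by
      ext (i | i) <;> rfl
    have h3 : (e134 ∘ middleRight : Fin n ⊕ Fin n → _) = e234 ∘ middleRight := by
      ext (i | i) <;> rfl
    simp only [stack, map_sup', map_map', h1, h2, h3]
    ac_rfl
  set T := (stack d₁ d₂).map e123 ⊔ (d₃.map middleRight).map e134 with hT
  have hL : T.comap e134 = stack (comp d₁ d₂) d₃ := by
    rw [hT, comap_sup_map]
    unfold stack comp
    congr 1
    refine comap_map_square i123 i134 ?_ ?_ _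
    · rintro (i | i) <;> rfl
    · rintro (i | i | i) (j | j | j) h <;> simp [e123, e134, leftRight] at h ⊢
  have hR : T.comap e124 = stack d₁ (comp d₂ d₃) := by
    rw [hTT, comap_sup_map, sup_comm]
    unfold stack comp
    congr 1
    refine comap_map_square i234 i124 ?_ ?_ _
    · rintro (i | i) <;> rfl
    · rintro (i | i | i) (j | j | j) h <;> simp [e234, e124, leftRight] at h ⊢
  constructor
  · rw [comp, ← hL, ← Setoid.comap_comp, comp, ← hR, ← Setoid.comap_comp]
    congr 1
    ext (i | i) <;> rfl
  · have hl := numComponentsIn_glue i123 i134 (middleColumn n) (middleColumn n)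
      (by rintro (i | i | i) <;> simp [middleColumn, e123, e134])
      (by rintro (i | i | i | i) <;> simp [e123, e134]) (stack d₁ d₂) (d₃.map middleRight)
    have hr := numComponentsIn_glue i234 i124 (middleColumn n) (middleColumn n)
      (by rintro (i | i | i) <;> simp [middleColumn, e234, e124])
      (by rintro (i | i | i | i) <;> simp [e234, e124]) (stack d₂ d₃) (d₁.map leftMiddle)
    rw [← hT, hL] at hl
    rw [← hTT, hR] at hr
    unfold loops
    rw [← hl, ← hr]
    congr 1
    ext (i | i | i | i) <;> simp [middleColumn, e123, e134, e124, e234]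

theorem comp_assoc (d₁ d₂ d₃ : PartitionDiagram n) :
    comp (comp d₁ d₂) d₃ = comp d₁ (comp d₂ d₃) := (assoc_aux d₁ d₂ d₃).1

theorem loops_assoc (d₁ d₂ d₃ : PartitionDiagram n) :
    loops d₁ d₂ + loops (comp d₁ d₂) d₃ = loops d₂ d₃ + loops d₁ (comp d₂ d₃) :=
  (assoc_aux d₁ d₂ d₃).2

end Composition

section Permutations

variable {n : ℕ}

/-- The propagating components: those with vertices in both columns. -/
def propagatingComponents (d : PartitionDiagram n) : Set (Set (Fin n ⊕ Fin n)) :=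
  {C | C ∈ d.classes ∧ (∃ i, Sum.inl i ∈ C) ∧ ∃ j, Sum.inr j ∈ C}

/-- Permutation diagrams: those with precisely `n` propagating components. -/
def IsPermutation (d : PartitionDiagram n) : Prop :=
  d.propagatingComponents.ncard = n

/-- The diagram of a permutation, with edges joining `i` on the right to `σ i` on the left. -/
@[reducible] def ofPerm (σ : Equiv.Perm (Fin n)) : PartitionDiagram n :=
  Setoid.ker (Sum.elim id σ)

theorem mem_propagatingComponents (d : PartitionDiagram n) (C : Set (Fin n ⊕ Fin n)) :
    C ∈ d.propagatingComponents ↔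
      ∃ i j, d (Sum.inr j) (Sum.inl i) ∧ C = {x | d x (Sum.inl i)} := by
  constructor
  · rintro ⟨⟨x, rfl⟩, ⟨i, hi⟩, ⟨j, hj⟩⟩
    refine ⟨i, j, d.trans' hj (d.symm' hi), ?_⟩
    ext y
    exact ⟨fun h => d.trans' h (d.symm' hi), fun h => d.trans' h hi⟩
  · rintro ⟨i, j, hij, rfl⟩
    exact ⟨⟨_, rfl⟩, ⟨i, d.refl' _⟩, ⟨j, hij⟩⟩

theorem isPermutation_iff' (d : PartitionDiagram n) :
    d.IsPermutation ↔ (∀ i i', d (Sum.inl i) (Sum.inl i') → i = i') ∧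
      ∀ i, ∃ j, d (Sum.inr j) (Sum.inl i) := by
  let F : Fin n → Set (Fin n ⊕ Fin n) := fun i => {x | d x (Sum.inl i)}
  have hF : ∀ i i', F i = F i' ↔ d (Sum.inl i) (Sum.inl i') := by
    intro i i'
    constructor
    · intro h
      have h1 : Sum.inl i ∈ F i := d.refl' _
      rw [h] at h1
      exact h1
    · intro h
      ext x
      exact ⟨fun hx => d.trans' hx h, fun hx => d.trans' hx (d.symm' h)⟩
  have hP : d.propagatingComponents = F '' {i | ∃ j, d (Sum.inr j) (Sum.inl i)} := by
    ext C
    rw [mem_propagatingComponents]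
    constructor
    · rintro ⟨i, j, h, rfl⟩
      exact ⟨i, ⟨j, h⟩, rfl⟩
    · rintro ⟨i, ⟨j, h⟩, rfl⟩
      exact ⟨i, j, h, rfl⟩
  unfold IsPermutation
  rw [hP]
  constructor
  · intro h
    have h1 : (F '' {i | ∃ j, d (Sum.inr j) (Sum.inl i)}).ncard ≤
        {i | ∃ j, d (Sum.inr j) (Sum.inl i)}.ncard := Set.ncard_image_le
    have h2 : {i | ∃ j, d (Sum.inr j) (Sum.inl i)} = Set.univ := by
      apply Set.eq_of_subset_of_ncard_le (Set.subset_univ _)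
      rw [Set.ncard_univ, Nat.card_eq_fintype_card, Fintype.card_fin]
      omega
    rw [h2] at h
    have hinj : Set.InjOn F Set.univ := by
      refine Set.injOn_of_ncard_image_eq ?_ (Set.toFinite _)
      rw [h, Set.ncard_univ, Nat.card_eq_fintype_card, Fintype.card_fin]
    refine ⟨fun i i' hii => hinj trivial trivial ((hF i i').2 hii), fun i => ?_⟩
    have : i ∈ {i | ∃ j, d (Sum.inr j) (Sum.inl i)} := h2 ▸ Set.mem_univ i
    exact this
  · rintro ⟨h1, h2⟩
    have h3 : {i | ∃ j, d (Sum.inr j) (Sum.inl i)} = Set.univ := Set.eq_univ_of_forall h2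
    rw [h3, Set.ncard_image_of_injective _ (fun i i' h => h1 i i' ((hF i i').1 h)),
      Set.ncard_univ, Nat.card_eq_fintype_card, Fintype.card_fin]

theorem isPermutation_iff (d : PartitionDiagram n) :
    d.IsPermutation ↔ ∃ σ, d = ofPerm σ := by
  rw [isPermutation_iff']
  constructor
  · rintro ⟨h1, h2⟩
    choose f hf using h2
    have hinj : f.Injective := fun i i' h =>
      h1 _ _ (d.trans' (d.symm' (hf i)) (h ▸ hf i'))
    let τ : Equiv.Perm (Fin n) := Equiv.ofBijective f (Finite.injective_iff_bijective.1 hinj)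
    have hτ : ∀ j, d (Sum.inr j) (Sum.inl (τ.symm j)) := by
      intro j
      have := hf (τ.symm j)
      rwa [show f (τ.symm j) = j from τ.apply_symm_apply j] at this
    have hx : ∀ x, d x (Sum.inl (Sum.elim id τ.symm x)) := by
      rintro (i | j)
      · exact d.refl' _
      · exact hτ j
    refine ⟨τ.symm, ?_⟩
    ext x y
    rw [ofPerm, Setoid.ker_def]
    constructor
    · intro h
      exact h1 _ _ (d.trans' (d.symm' (hx x)) (d.trans' h (hx y)))
    · intro h
      exact d.trans' (hx x) (h ▸ d.symm' (hx y))
  · rintro ⟨σ, rfl⟩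
    exact ⟨fun i i' h => h, fun i => ⟨σ.symm i, by simp [Setoid.ker_def]⟩⟩

theorem isPermutation_ofPerm (σ : Equiv.Perm (Fin n)) : (ofPerm σ).IsPermutation :=
  (isPermutation_iff _).2 ⟨σ, rfl⟩

/-- Stacking a permutation diagram on the left relabels the left column. -/
theorem stack_ofPerm_left (σ : Equiv.Perm (Fin n)) (d : PartitionDiagram n) :
    stack (ofPerm σ) d = d.comap (Sum.elim (fun i => Sum.inl (σ.symm i)) id) := by
  have hL : ∀ i j, σ i = j → stack (ofPerm σ) d (Sum.inl j) (Sum.inr (Sum.inl i)) := by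
    intro i j h
    refine (le_sup_left : _ ≤ stack (ofPerm σ) d)
      (Relation.EqvGen.rel _ _ ⟨Sum.inl j, Sum.inr i, ?_, rfl, rfl⟩)
    simp [Setoid.ker_def, h]
  have hR : ∀ x y, d x y → stack (ofPerm σ) d (Sum.inr x) (Sum.inr y) := by
    intro x y h
    exact (le_sup_right : _ ≤ stack (ofPerm σ) d) (Relation.EqvGen.rel _ _ ⟨x, y, h, rfl, rfl⟩)
  refine le_antisymm (sup_le ?_ ?_) ?_
  · rw [map_le_iff]
    rintro x y h
    have : ∀ x : Fin n ⊕ Fin n, Sum.elim (fun i => Sum.inl (σ.symm i)) id (leftMiddle x) =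
        (Sum.inl (σ.symm (Sum.elim id σ x)) : Fin n ⊕ Fin n) := by
      rintro (i | i) <;> simp [leftMiddle]
    rw [ofPerm, Setoid.ker_def] at h
    rw [Setoid.comap_rel, Setoid.comap_rel, this, this, h]
  · rw [map_le_iff]
    intro x y h
    exact h
  · have hx : ∀ x, stack (ofPerm σ) d x
        (Sum.inr (Sum.elim (fun i => Sum.inl (σ.symm i)) id x)) := by
      rintro (i | x)
      · exact hL _ _ (by simp)
      · exact (stack (ofPerm σ) d).refl' _
    intro x y h
    exact (stack (ofPerm σ) d).trans' (hx x)
      ((stack (ofPerm σ) d).trans' (hR _ _ h) ((stack (ofPerm σ) d).symm' (hx y)))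

/-- Stacking a permutation diagram on the right relabels the right column. -/
theorem stack_ofPerm_right (σ : Equiv.Perm (Fin n)) (d : PartitionDiagram n) :
    stack d (ofPerm σ) =
      d.comap (Sum.elim Sum.inl (Sum.elim Sum.inr fun j => Sum.inr (σ j))) := by
  have hL : ∀ i j, σ i = j →
      stack d (ofPerm σ) (Sum.inr (Sum.inr i)) (Sum.inr (Sum.inl j)) := by
    intro i j h
    refine (le_sup_right : _ ≤ stack d (ofPerm σ))
      (Relation.EqvGen.rel _ _ ⟨Sum.inr i, Sum.inl j, ?_, rfl, rfl⟩)
    simp [Setoid.ker_def, h]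
  have hR : ∀ x y, d x y → stack d (ofPerm σ) (leftMiddle x) (leftMiddle y) := by
    intro x y h
    exact (le_sup_left : _ ≤ stack d (ofPerm σ)) (Relation.EqvGen.rel _ _ ⟨x, y, h, rfl, rfl⟩)
  refine le_antisymm (sup_le ?_ ?_) ?_
  · rw [map_le_iff]
    rintro (x | x) (y | y) h <;> exact h
  · rw [map_le_iff]
    rintro x y h
    have : ∀ x : Fin n ⊕ Fin n,
        Sum.elim Sum.inl (Sum.elim Sum.inr fun j => Sum.inr (σ j)) (middleRight x) =
        (Sum.inr (Sum.elim id σ x) : Fin n ⊕ Fin n) := by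
      rintro (i | i) <;> simp [middleRight]
    rw [ofPerm, Setoid.ker_def] at h
    rw [Setoid.comap_rel, Setoid.comap_rel, this, this, h]
  · have hx : ∀ x, stack d (ofPerm σ) x (leftMiddle
        (Sum.elim Sum.inl (Sum.elim Sum.inr fun j => Sum.inr (σ j)) x)) := by
      rintro (i | i | i)
      · exact (stack d (ofPerm σ)).refl' _
      · exact (stack d (ofPerm σ)).refl' _
      · exact hL _ _ rfl
    intro x y h
    exact (stack d (ofPerm σ)).trans' (hx x)
      ((stack d (ofPerm σ)).trans' (hR _ _ h) ((stack d (ofPerm σ)).symm' (hx y)))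

theorem loops_eq_zero (d₁ d₂ : PartitionDiagram n)
    (h : ∀ i, ∃ x, stack d₁ d₂ (leftRight x) (Sum.inr (Sum.inl i))) : loops d₁ d₂ = 0 := by
  unfold loops numComponentsIn
  rw [Set.ncard_eq_zero, Set.eq_empty_iff_forall_notMem]
  rintro _ ⟨⟨x, rfl⟩, hC⟩
  obtain ⟨i, rfl⟩ := hC ((stack d₁ d₂).refl' x)
  obtain ⟨y, hy⟩ := h i
  obtain ⟨j, hj⟩ := hC hy
  rcases y with y | y <;> simp [leftRight] at hj

theorem loops_ofPerm_left (σ : Equiv.Perm (Fin n)) (d : PartitionDiagram n) :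
    loops (ofPerm σ) d = 0 := by
  refine loops_eq_zero _ _ fun i => ⟨Sum.inl (σ i), ?_⟩
  rw [stack_ofPerm_left, Setoid.comap_rel]
  simp [leftRight]

theorem loops_ofPerm_right (σ : Equiv.Perm (Fin n)) (d : PartitionDiagram n) :
    loops d (ofPerm σ) = 0 := by
  refine loops_eq_zero _ _ fun i => ⟨Sum.inr (σ.symm i), ?_⟩
  rw [stack_ofPerm_right, Setoid.comap_rel]
  simp [leftRight]

theorem comp_ofPerm_left (σ : Equiv.Perm (Fin n)) (d : PartitionDiagram n) :
    comp (ofPerm σ) d = d.comap (Sum.map σ.symm id) := by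
  rw [comp, stack_ofPerm_left, ← Setoid.comap_comp]
  congr 1
  ext (i | i) <;> rfl

theorem comp_ofPerm_right (σ : Equiv.Perm (Fin n)) (d : PartitionDiagram n) :
    comp d (ofPerm σ) = d.comap (Sum.map id σ) := by
  rw [comp, stack_ofPerm_right, ← Setoid.comap_comp]
  congr 1
  ext (i | i) <;> rfl

theorem ofPerm_comp_ofPerm (σ τ : Equiv.Perm (Fin n)) :
    comp (ofPerm σ) (ofPerm τ) = ofPerm (σ * τ) := by
  rw [comp_ofPerm_left]
  ext x y
  have h : ∀ x : Fin n ⊕ Fin n, Sum.elim id τ (Sum.map σ.symm id x) =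
      σ.symm (Sum.elim id (σ * τ) x) := by
    rintro (i | i) <;> simp
  rw [Setoid.comap_rel, ofPerm, ofPerm, Setoid.ker_def, Setoid.ker_def, h, h]
  exact σ.symm.injective.eq_iff

theorem isPermutation_of_comp {d₁ d₂ : PartitionDiagram n} (h : (comp d₁ d₂).IsPermutation) :
    d₁.IsPermutation ∧ d₂.IsPermutation := by
  rw [isPermutation_iff'] at h
  obtain ⟨h1, h2⟩ := h
  have hl : ∀ x y, d₁ x y → stack d₁ d₂ (leftMiddle x) (leftMiddle y) := fun x y h =>
    (le_sup_left : _ ≤ stack d₁ d₂) (Relation.EqvGen.rel _ _ ⟨x, y, h, rfl, rfl⟩)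
  have hr : ∀ x y, d₂ x y → stack d₁ d₂ (middleRight x) (middleRight y) := fun x y h =>
    (le_sup_right : _ ≤ stack d₁ d₂) (Relation.EqvGen.rel _ _ ⟨x, y, h, rfl, rfl⟩)
  have a1 : ∀ i i', d₁ (Sum.inl i) (Sum.inl i') → i = i' := fun i i' h => h1 i i' (hl _ _ h)
  -- every left vertex of `d₁` is joined to a middle vertex
  have a2 : ∀ i, ∃ j, d₁ (Sum.inr j) (Sum.inl i) := by
    intro i
    by_contra hcon
    push Not at hcon
    have hle : stack d₁ d₂ ≤ Setoid.ker (fun x => ∃ i', x = Sum.inl i' ∧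
        d₁ (Sum.inl i') (Sum.inl i)) := by
      refine sup_le ?_ ?_
      · rw [map_le_iff]
        have aux : ∀ x : Fin n ⊕ Fin n, (∃ i', leftMiddle x = Sum.inl i' ∧
            d₁ (Sum.inl i') (Sum.inl i)) ↔ d₁ x (Sum.inl i) := by
          rintro (x | x)
          · simp [leftMiddle]
          · simp [leftMiddle, hcon x]
        intro x y hxy
        rw [Setoid.comap_rel, Setoid.ker_def, eq_iff_iff, aux, aux]
        exact ⟨fun h => d₁.trans' (d₁.symm' hxy) h, fun h => d₁.trans' hxy h⟩
      · rw [map_le_iff]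
        intro x y _
        simp [Setoid.ker_def, middleRight]
    obtain ⟨j, hj⟩ := h2 i
    have := hle hj
    rw [Setoid.ker_def, eq_iff_iff] at this
    obtain ⟨_, h, _⟩ := this.2 ⟨i, rfl, d₁.refl' _⟩
    simp [leftRight] at h
  have hp1 : d₁.IsPermutation := (isPermutation_iff' _).2 ⟨a1, a2⟩
  refine ⟨hp1, ?_⟩
  obtain ⟨σ, rfl⟩ := (isPermutation_iff _).1 hp1
  rw [isPermutation_iff']
  rw [comp_ofPerm_left] at h1 h2
  simp only [Setoid.comap_rel, Sum.map_inl, Sum.map_inr, id] at h1 h2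
  constructor
  · intro i i' h
    have := h1 (σ i) (σ i') (by simpa using h)
    exact σ.injective this
  · intro i
    simpa using h2 (σ i)

end Permutations

end PartitionDiagram

/-- The partition algebra `P_n(δ)`: the free `k`-module on the partition `n`-diagrams. -/
def PartitionAlgebra (k : Type u) [CommRing k] (_δ : k) (n : ℕ) : Type u :=
  PartitionDiagram n →₀ k

namespace PartitionAlgebra

open PartitionDiagram

section

variable {k : Type u} [CommRing k] (δ : k) (n : ℕ)

noncomputable instance : AddCommGroup (PartitionAlgebra k δ n) :=
  inferInstanceAs (AddCommGroup (PartitionDiagram n →₀ k))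

noncomputable instance : Module k (PartitionAlgebra k δ n) :=
  inferInstanceAs (Module k (PartitionDiagram n →₀ k))

/-- The basis of the partition algebra consisting of all diagrams. -/
noncomputable def diagramBasis : Module.Basis (PartitionDiagram n) k (PartitionAlgebra k δ n) :=
  Module.Basis.ofRepr (LinearEquiv.refl k (PartitionDiagram n →₀ k))

/-- The multiplication: the bilinear extension of `d₁ d₂ = δ ^ α • d₃`. -/
noncomputable def mulBilin :
    PartitionAlgebra k δ n →ₗ[k] PartitionAlgebra k δ n →ₗ[k] PartitionAlgebra k δ n :=
  (diagramBasis δ n).constr k fun d₁ => (diagramBasis δ n).constr k fun d₂ =>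
    δ ^ loops d₁ d₂ • diagramBasis δ n (comp d₁ d₂)

noncomputable instance : Mul (PartitionAlgebra k δ n) := ⟨fun x y => mulBilin δ n x y⟩

noncomputable instance : One (PartitionAlgebra k δ n) := ⟨diagramBasis δ n (ofPerm 1)⟩

theorem mul_def (x y : PartitionAlgebra k δ n) : x * y = mulBilin δ n x y := rfl

theorem one_def : (1 : PartitionAlgebra k δ n) = diagramBasis δ n (ofPerm 1) := rfl

/-- The product of two diagrams. -/
theorem diagram_mul (d₁ d₂ : PartitionDiagram n) :
    diagramBasis δ n d₁ * diagramBasis δ n d₂ =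
      δ ^ loops d₁ d₂ • diagramBasis δ n (comp d₁ d₂) := by
  rw [mul_def, mulBilin, Module.Basis.constr_basis, Module.Basis.constr_basis]

theorem induction_diagram {p : PartitionAlgebra k δ n → Prop} (x : PartitionAlgebra k δ n)
    (zero : p 0) (add : ∀ x y, p x → p y → p (x + y))
    (smul : ∀ (a : k) d, p (a • diagramBasis δ n d)) : p x := by
  classical
  have : Finite (PartitionDiagram n) :=
    Finite.of_injective (fun (r : PartitionDiagram n) x y => r x y)
      fun r s h => Setoid.ext fun x y => iff_of_eq (congrFun (congrFun h x) y)
  have := Fintype.ofFinite (PartitionDiagram n)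
  rw [← (diagramBasis δ n).sum_repr x]
  exact Finset.sum_induction _ p add zero fun d _ => smul _ d

noncomputable instance : NonUnitalNonAssocRing (PartitionAlgebra k δ n) :=
  { (inferInstance : AddCommGroup (PartitionAlgebra k δ n)),
    (inferInstance : Mul (PartitionAlgebra k δ n)) with
    left_distrib := fun x y z => ((mulBilin δ n) x).map_add y z
    right_distrib := fun x y z => LinearMap.map_add₂ (mulBilin δ n) x y z
    zero_mul := fun x => LinearMap.map_zero₂ (mulBilin δ n) x
    mul_zero := fun x => ((mulBilin δ n) x).map_zero }

theorem smul_mul' (a : k) (x y : PartitionAlgebra k δ n) : a • x * y = a • (x * y) :=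
  LinearMap.map_smul₂ (mulBilin δ n) a x y

theorem mul_smul' (a : k) (x y : PartitionAlgebra k δ n) : x * a • y = a • (x * y) :=
  ((mulBilin δ n) x).map_smul a y

theorem mul_assoc' (x y z : PartitionAlgebra k δ n) : x * y * z = x * (y * z) := by
  induction x using induction_diagram with
  | zero => simp
  | add x x' hx hx' => simp only [add_mul, hx, hx']
  | smul a d₁ =>
    induction y using induction_diagram with
    | zero => simp
    | add y y' hy hy' => simp only [add_mul, mul_add, hy, hy']
    | smul b d₂ =>
      induction z using induction_diagram with
      | zero => simp
      | add z z' hz hz' => simp only [mul_add, hz, hz']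
      | smul c d₃ =>
        simp only [smul_mul', mul_smul', diagram_mul, smul_smul, ← comp_assoc]
        congr 1
        have h : δ ^ loops d₁ d₂ * δ ^ loops (comp d₁ d₂) d₃ =
            δ ^ loops d₂ d₃ * δ ^ loops d₁ (comp d₂ d₃) := by
          rw [← pow_add, ← pow_add, loops_assoc]
        linear_combination (a * b * c) * h

theorem one_mul' (x : PartitionAlgebra k δ n) : 1 * x = x := by
  induction x using induction_diagram with
  | zero => simp
  | add x y hx hy => rw [mul_add, hx, hy]
  | smul a d =>
    rw [mul_smul', one_def, diagram_mul, loops_ofPerm_left, comp_ofPerm_left, pow_zero, one_smul]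
    congr 2
    ext (i | i) (j | j) <;> rfl

theorem mul_one' (x : PartitionAlgebra k δ n) : x * 1 = x := by
  induction x using induction_diagram with
  | zero => simp
  | add x y hx hy => rw [add_mul, hx, hy]
  | smul a d =>
    rw [smul_mul', one_def, diagram_mul, loops_ofPerm_right, comp_ofPerm_right, pow_zero,
      one_smul]
    congr 2
    ext (i | i) (j | j) <;> rfl

noncomputable instance : Ring (PartitionAlgebra k δ n) :=
  { (inferInstance : NonUnitalNonAssocRing (PartitionAlgebra k δ n)),
    (inferInstance : One (PartitionAlgebra k δ n)) with
    mul_assoc := mul_assoc' δ n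
    one_mul := one_mul' δ n
    mul_one := mul_one' δ n }

noncomputable instance : Algebra k (PartitionAlgebra k δ n) :=
  Algebra.ofModule (smul_mul' δ n) (fun a x y => mul_smul' δ n a x y)

open Classical in
/-- The augmentation, as a linear map: permutation diagrams go to `1`, all others to `0`. -/
noncomputable def augmentationLinear : PartitionAlgebra k δ n →ₗ[k] k :=
  (diagramBasis δ n).constr k fun d => if d.IsPermutation then 1 else 0

open Classical in
theorem augmentationLinear_diagram (d : PartitionDiagram n) :
    augmentationLinear δ n (diagramBasis δ n d) = if d.IsPermutation then 1 else 0 :=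
  (diagramBasis δ n).constr_basis k _ d

/-- The augmentation `ε : P_n(δ) → k`. -/
noncomputable def augmentation : PartitionAlgebra k δ n →ₐ[k] k :=
  AlgHom.ofLinearMap (augmentationLinear δ n)
    (by rw [one_def, augmentationLinear_diagram, if_pos (isPermutation_ofPerm 1)])
    (by
      intro x y
      induction x using induction_diagram with
      | zero => simp
      | add x x' hx hx' => simp only [add_mul, map_add, hx, hx']
      | smul a d₁ =>
        induction y using induction_diagram with
        | zero => simp
        | add y y' hy hy' => simp only [mul_add, map_add, hy, hy']
        | smul b d₂ =>
          simp only [smul_mul', mul_smul', diagram_mul, map_smul, augmentationLinear_diagram,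
            smul_eq_mul]
          by_cases h : (comp d₁ d₂).IsPermutation
          · obtain ⟨h1, h2⟩ := isPermutation_of_comp h
            obtain ⟨σ, rfl⟩ := (isPermutation_iff _).1 h1
            rw [loops_ofPerm_left, if_pos h, if_pos h1, if_pos h2]
            ring
          · have h' : ¬ (d₁.IsPermutation ∧ d₂.IsPermutation) := by
              rintro ⟨h1, h2⟩
              obtain ⟨σ, rfl⟩ := (isPermutation_iff _).1 h1
              obtain ⟨τ, rfl⟩ := (isPermutation_iff _).1 h2
              rw [ofPerm_comp_ofPerm] at h
              exact h (isPermutation_ofPerm _)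
            rw [if_neg h]
            by_cases h1 : d₁.IsPermutation
            · rw [if_neg (fun h2 => h' ⟨h1, h2⟩)]
              ring
            · rw [if_neg h1]
              ring)

theorem augmentation_ofPerm (σ : Equiv.Perm (Fin n)) :
    augmentation δ n (diagramBasis δ n (ofPerm σ)) = 1 :=
  (augmentationLinear_diagram δ n _).trans (if_pos (isPermutation_ofPerm σ))

/-- The inclusion of the symmetric group as the permutation diagrams. -/
noncomputable def permHom : Equiv.Perm (Fin n) →* PartitionAlgebra k δ n where
  toFun σ := diagramBasis δ n (ofPerm σ)
  map_one' := rfl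
  map_mul' σ τ := by
    rw [diagram_mul, loops_ofPerm_left, pow_zero, one_smul, ofPerm_comp_ofPerm]

end

end PartitionAlgebra

/-! ### Cohomology of augmented algebras and restriction to a group -/

namespace AugmentedAlgebra

open CategoryTheory
open scoped ModuleCat.Algebra

variable {k : Type u} [CommRing k] {A : Type u} [Ring A] [Algebra k A] (ε : A →ₐ[k] k)

/-- The trivial module `𝟙` of an augmented algebra: the ground ring `k`, on which `A` acts via the
augmentation. -/
noncomputable abbrev trivialModule : ModuleCat.{u} A :=
  (ModuleCat.restrictScalars ε.toRingHom).obj (ModuleCat.of k k)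

/-- The cohomology `Ext_A^q(𝟙, 𝟙)` of an augmented `k`-algebra; it is a `k`-module. -/
abbrev Cohomology (q : ℕ) : Type u :=
  Abelian.Ext (trivialModule ε) (trivialModule ε) q

noncomputable instance cohomologyModule (q : ℕ) : Module k (Cohomology ε q) :=
  inferInstanceAs (Module k (Abelian.Ext (trivialModule ε) (trivialModule ε) q))

section Restriction

variable {G : Type u} [Group G] (φ : G →* A)

/-- The functor regarding an `A`-module as a `k`-linear representation of `G`, along a
homomorphism `φ : G → A`: the element `g` acts as `φ g`. -/
noncomputable def toRep : ModuleCat.{u} A ⥤ Rep.{u} k G where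
  obj M := Rep.of (X := M) ((Module.toModuleEnd k M).toMonoidHom.comp
    φ : Representation k G M)
  map f := Rep.ofHom
    { toFun := f.hom
      map_add' := f.hom.map_add
      map_smul' := fun r x => f.hom.map_smul (algebraMap k A r) x
      isIntertwining' := fun g => by
        ext x
        exact f.hom.map_smul (φ g) x }

noncomputable instance : (toRep (k := k) φ).Additive where
  map_add := rfl

theorem restrictScalars_exact {R S : Type u} [Ring R] [Ring S] (f : R →+* S) :
    Limits.PreservesFiniteLimits (ModuleCat.restrictScalars.{u} f) ∧
      Limits.PreservesFiniteColimits (ModuleCat.restrictScalars.{u} f) :=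
  ((CategoryTheory.Functor.exact_tfae (ModuleCat.restrictScalars.{u} f)).out 1 3).mp
    (fun S hS => by
      rw [CategoryTheory.ShortComplex.ShortExact.moduleCat_exact_iff_function_exact] at hS ⊢
      exact hS)

theorem toRep_forget : toRep (k := k) φ ⋙ forget₂ (Rep.{u} k G) (ModuleCat.{u} k) =
    ModuleCat.restrictScalars (algebraMap k A) := rfl

noncomputable instance : Limits.PreservesFiniteLimits (toRep (k := k) φ) where
  preservesFiniteLimits J _ _ := by
    have := (restrictScalars_exact (algebraMap k A)).1
    have : Limits.PreservesLimitsOfShape J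
        (toRep (k := k) φ ⋙ forget₂ (Rep.{u} k G) (ModuleCat.{u} k)) := by
      rw [toRep_forget]
      infer_instance
    exact Limits.preservesLimitsOfShape_of_reflects_of_preserves _
      (forget₂ (Rep.{u} k G) (ModuleCat.{u} k))

noncomputable instance : Limits.PreservesFiniteColimits (toRep (k := k) φ) where
  preservesFiniteColimits J _ _ := by
    have := (restrictScalars_exact (algebraMap k A)).2
    have : Limits.PreservesColimitsOfShape J
        (toRep (k := k) φ ⋙ forget₂ (Rep.{u} k G) (ModuleCat.{u} k)) := by
      rw [toRep_forget]
      infer_instance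
    exact Limits.preservesColimitsOfShape_of_reflects_of_preserves _
      (forget₂ (Rep.{u} k G) (ModuleCat.{u} k))

noncomputable instance : HasExt.{u} (Rep.{u} k G) := hasExt_of_enoughProjectives.{u} _

/-- An `A`-module whose underlying `k`-module is `k` and on which `G` acts trivially is the trivial
representation `k`. -/
noncomputable def toRepIsoTrivial (M : ModuleCat.{u} A) (f : M ≃+ k)
    (hk : ∀ (r : k) (x : M), f (algebraMap k A r • x) = r * f x)
    (hG : ∀ (g : G) (x : M), f (φ g • x) = f x) :
    (toRep φ).obj M ≅ Rep.trivial k G k :=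
  Rep.mkIso
    { f with
      map_smul' := hk
      isIntertwining' := fun g => by
        ext x
        exact hG g x }

/-- If `ε (φ g) = 1` for all `g`, the trivial `A`-module becomes the trivial representation `k`
(the underlying map is the identity of `k`). -/
noncomputable def toRepTrivial (hφ : ∀ g, ε (φ g) = 1) :
    (toRep φ).obj (trivialModule ε) ≅ Rep.trivial k G k :=
  toRepIsoTrivial φ (trivialModule ε) (AddEquiv.refl k)
    (fun r x => congrArg (fun a : k => a * (show k from x)) (ε.commutes r))
    (fun g x => (congrArg (fun a : k => a * (show k from x)) (hφ g)).trans (one_mul _))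

/-- The restriction map `Ext_A^q(𝟙, 𝟙) → Ext_G^q(k, k)` along `φ : G → A`. -/
noncomputable def restrict (hφ : ∀ g, ε (φ g) = 1) (q : ℕ) (x : Cohomology ε q) :
    Abelian.Ext (Rep.trivial k G k) (Rep.trivial k G k) q :=
  (Abelian.Ext.mk₀ (toRepTrivial ε φ hφ).inv).comp
    ((x.mapExactFunctor (toRep (k := k) φ)).comp
      (Abelian.Ext.mk₀ (toRepTrivial ε φ hφ).hom) (add_zero q)) (zero_add q)

end Restriction

end AugmentedAlgebra

namespace GroupCohomologyClass

open CategoryTheory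

variable {k G : Type u} [CommRing k] [Group G]

theorem bar_d_comp (V : Rep.{u} k G) (q : ℕ) (z : groupCohomology.cocycles V q) :
    (Rep.barResolution k G).complex.d (q + 1) q ≫
      ((Rep.freeLiftLEquiv k G (Fin q → G) V).symm (groupCohomology.iCocycles V q z) :
        Rep.free k G (Fin q → G) ⟶ V) = 0 := by
  have h1 : inhomogeneousCochains.d V q (groupCohomology.iCocycles V q z) = 0 := by
    have := congrArg (fun f => f.hom z)
      ((groupCohomology.inhomogeneousCochains V).iCycles_d q (q + 1))
    rw [groupCohomology.inhomogeneousCochains.d_def] at this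
    exact this
  rw [inhomogeneousCochains.d_eq] at h1
  exact (Rep.freeLiftLEquiv k G (Fin (q + 1) → G) V).injective (h1.trans (map_zero _).symm)

/-- The class in `Ext_G^q(k, V)` of an inhomogeneous `q`-cocycle `Gᵠ → V`, computed with the bar
resolution of `k`. -/
noncomputable def ofCocycle (V : Rep.{u} k G) (q : ℕ) (z : groupCohomology.cocycles V q) :
    Abelian.Ext (Rep.trivial k G k) V q :=
  (Rep.barResolution k G).extMk
    ((Rep.freeLiftLEquiv k G (Fin q → G) V).symm (groupCohomology.iCocycles V q z) :
        Rep.free k G (Fin q → G) ⟶ V) (q + 1) rfl (bar_d_comp V q z)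

end GroupCohomologyClass

/-! ### Cohomology of the partition algebra -/

/-- The symmetric group `Σ_n` (lifted to the universe of the ground ring). -/
abbrev SymmetricGroup (n : ℕ) : Type u := ULift.{u} (Equiv.Perm (Fin n))

namespace PartitionAlgebra

variable {k : Type u} [CommRing k] (δ : k) (n q : ℕ)

/-- The augmentation on the opposite algebra.  Right `P_n(δ)`-modules are the modules over
`P_n(δ)ᵐᵒᵖ`. -/
noncomputable def rightAugmentation : (PartitionAlgebra k δ n)ᵐᵒᵖ →ₐ[k] k :=
  (augmentation δ n).fromOpposite fun _ _ => Commute.all _ _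

/-- The cohomology `Ext_{P_n(δ)}^q(𝟙, 𝟙)` of the partition algebra, where `Ext` is taken in the
category of right `P_n(δ)`-modules and `𝟙` is the trivial module. -/
abbrev Cohomology : Type u := AugmentedAlgebra.Cohomology (rightAugmentation δ n) q

/-- The homomorphism through which `Σ_n` acts on right `P_n(δ)`-modules: the element `σ` acts on
the left as right multiplication by the diagram of `σ⁻¹`. -/
noncomputable def permHomRight : SymmetricGroup.{u} n →* (PartitionAlgebra k δ n)ᵐᵒᵖ where
  toFun σ := MulOpposite.op (permHom δ n σ.down⁻¹)
  map_one' := by simp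
  map_mul' σ τ := by simp [← MulOpposite.op_mul]

theorem rightAugmentation_permHomRight (σ : SymmetricGroup.{u} n) :
    rightAugmentation δ n (permHomRight δ n σ) = 1 :=
  augmentation_ofPerm δ n σ.down⁻¹

/-- The restriction map `Ext_{P_n(δ)}^q(𝟙, 𝟙) → Ext_{Σ_n}^q(𝟙, 𝟙)` along the inclusion of the
permutation diagrams. -/
noncomputable def restrict (x : Cohomology δ n q) :
    CategoryTheory.Abelian.Ext (Rep.trivial k (SymmetricGroup.{u} n) k)
      (Rep.trivial k (SymmetricGroup.{u} n) k) q :=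
  AugmentedAlgebra.restrict (rightAugmentation δ n) (permHomRight δ n)
    (rightAugmentation_permHomRight δ n) q x

end PartitionAlgebra

/-!
Write `B` for the opposite of the partition algebra, so that right modules over the partition
algebra are left `B`-modules, and `I` for the ideal spanned by the diagrams that are not
permutation diagrams.  Then `B ⧸ I` is the group algebra of the symmetric group, and the trivial
module is killed by `I`.

The heart of the matter is that `Ext_B^q(I, 𝟙) = 0` for `q < n - 1`.  A diagram is not a
permutation diagram if and only if, in its left-hand column, some vertex is isolated or two
vertices lie in the same component (`not_isPermutation_iff`).  So `I` is the sum of the right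
ideals spanned by the diagrams with a given isolated vertex, respectively with two given vertices
joined.  An intersection of such ideals is the ideal of diagrams in which the vertices of a set
`S` are isolated and those related by some equivalence relation are joined.  If `S` is not the
whole column, then this ideal is zero or generated by an idempotent of `I`: isolated vertices can
be absorbed into the component of another vertex on the right-hand side, which makes `δ` disappear
from the product (`LeftCondition.idempotent`).  Such an ideal is projective and has no
homomorphisms to `𝟙` (`ExtVanishesBelow.span_idempotent`).  Intersections of fewer than `n` of the
ideals never isolate all `n` vertices, and repeated Mayer–Vietoris sequences, which lose one
degree per intersection, give the vanishing (`extVanishesBelow_diagramsUnion`).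

It follows that `Ext_B^q(B ⧸ I, 𝟙) = 0` for `0 < q < n`, and likewise for all direct sums of
copies of `B ⧸ I`.  These restrict to free modules over the group algebra, and every module killed
by `I` is a quotient of one of them, again with kernel killed by `I`.  Dimension shifting compares
the two `Ext` groups, starting from the fact that between modules killed by `I` there is no
difference between `B`-linear and equivariant maps; so restriction
`Ext_B^q(X, 𝟙) → Ext_{Σ_n}^q(X, 𝟙)` is bijective for `q < n` and all `X` killed by `I` (`mapExt_toRep_bijective`).  The
isomorphism with group cohomology is the composite of this map for `X = 𝟙` with the inverse of the
isomorphism given by the bar resolution (`GroupCohomologyClass.extEquiv`).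
-/

/-! ### Vanishing of `Ext` and comparison along exact functors -/

section

open CategoryTheory

namespace CategoryTheory.ShortComplex.ShortExact

open Abelian

variable {C : Type*} [Category C] [Abelian C] [HasExt C] {S : ShortComplex C}

theorem ext_middle_eq_zero (hS : S.ShortExact) {Y : C} {q : ℕ}
    (h₁ : ∀ x : Ext S.X₁ Y q, x = 0) (h₃ : ∀ x : Ext S.X₃ Y q, x = 0) (x : Ext S.X₂ Y q) :
    x = 0 := by
  obtain ⟨y, rfl⟩ := Ext.contravariant_sequence_exact₂ hS Y x (h₁ _)
  rw [h₃ y, Ext.comp_zero]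

theorem ext_right_zero_eq_zero (hS : S.ShortExact) {Y : C}
    (h₂ : ∀ x : Ext S.X₂ Y 0, x = 0) (x : Ext S.X₃ Y 0) : x = 0 := by
  have := hS.epi_g
  refine Ext.precomp_mk₀_injective_of_epi Y S.g ?_
  rw [map_zero]
  exact h₂ _

theorem ext_right_succ_eq_zero (hS : S.ShortExact) {Y : C} {q : ℕ}
    (h₁ : ∀ x : Ext S.X₁ Y q, x = 0) (h₂ : ∀ x : Ext S.X₂ Y (q + 1), x = 0)
    (x : Ext S.X₃ Y (q + 1)) : x = 0 := by
  obtain ⟨y, rfl⟩ := Ext.contravariant_sequence_exact₃ hS Y x (h₂ _) (add_comm 1 q)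
  rw [h₁ y, Ext.comp_zero]

end CategoryTheory.ShortComplex.ShortExact

section Comparison

open Limits Abelian

variable {C : Type*} [Category C] [Abelian C] [HasExt C] {D : Type*} [Category D] [Abelian D]
  [HasExt D] (F : C ⥤ D) [F.Additive] [PreservesFiniteLimits F] [PreservesFiniteColimits F]

/-- An exact functor is bijective on `Ext^q(X, Y)` for `q ≤ m` and all `X` in a class `W` of objects
if it is bijective on morphisms from `W` to `Y` and if every object of `W` is a quotient, with
kernel in `W`, of an object of `W` for which `Ext` to `Y` vanishes in degrees `1, …, m` before and
after applying the functor.  This is dimension shifting with relatively acyclic objects in place of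
projective ones. -/
theorem mapExt_bijective_of_resolving (W : C → Prop) (Y : C) (m : ℕ)
    (hW : ∀ X, W X → ∃ (S : ShortComplex C), S.ShortExact ∧ S.X₃ = X ∧ W S.X₁ ∧ W S.X₂ ∧
      (∀ q < m, ∀ x : Ext S.X₂ Y (q + 1), x = 0) ∧
      ∀ q < m, ∀ x : Ext (F.obj S.X₂) (F.obj Y) (q + 1), x = 0)
    (hom : ∀ X, W X → Function.Bijective (F.map : (X ⟶ Y) → (F.obj X ⟶ F.obj Y)))
    (q : ℕ) (hq : q ≤ m) (X : C) (hX : W X) :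
    Function.Bijective (F.mapExtAddHom X Y q) := by
  induction q generalizing X with
  | zero =>
    rw [Functor.mapExtAddHom_coe, Ext.mapExactFunctor₀]
    exact Ext.homEquiv₀.symm.bijective.comp ((hom X hX).comp Ext.homEquiv₀.bijective)
  | succ q ih =>
    obtain ⟨S, hS, rfl, h₁, h₂, hC, hD⟩ := hW X hX
    exact AddMonoidHom.bijective_of_surjective_of_bijective_of_right_exact _ _ _ _
      (F.mapExtAddHom S.X₂ Y q) (F.mapExtAddHom S.X₁ Y q) (F.mapExtAddHom S.X₃ Y (q + 1))
      (by ext x; simp [Ext.mapExactFunctor_comp, Ext.mapExactFunctor_mk₀]; rfl)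
      (by ext x; simp [Ext.mapExactFunctor_comp, Ext.mapExactFunctor_extClass]; rfl)
      ((ShortComplex.ab_exact_iff_function_exact _).1
        (Ext.contravariant_sequence_exact₁' hS Y q (q + 1) (add_comm 1 q)))
      ((ShortComplex.ab_exact_iff_function_exact _).1
        (Ext.contravariant_sequence_exact₁' (hS.map_of_exact F) (F.obj Y) q (q + 1)
          (add_comm 1 q)))
      (ih (by omega) _ h₂).surjective (ih (by omega) _ h₁)
      (fun x ↦ Ext.contravariant_sequence_exact₃ hS _ x (hC q (by omega) _) (add_comm 1 q))
      (fun y ↦ Ext.contravariant_sequence_exact₃ (hS.map_of_exact F) _ y (hD q (by omega) _)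
        (add_comm 1 q))

end Comparison

section ModuleCat

open Abelian

variable {B : Type u} [Ring B]

theorem shortExact_finsupp {N₁ N₂ N₃ : Type u} [AddCommGroup N₁] [Module B N₁] [AddCommGroup N₂]
    [Module B N₂] [AddCommGroup N₃] [Module B N₃] (S : Type u) (f : N₁ →ₗ[B] N₂)
    (g : N₂ →ₗ[B] N₃) (hf : Function.Injective f) (hfg : Function.Exact f g)
    (hg : Function.Surjective g) :
    (ShortComplex.mk (ModuleCat.ofHom (Finsupp.mapRange.linearMap (α := S) f))
      (ModuleCat.ofHom (Finsupp.mapRange.linearMap (α := S) g)) (by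
        ext x s
        simp [hfg.apply_apply_eq_zero])).ShortExact := by
  have hf' : Function.Injective (Finsupp.mapRange.linearMap (α := S) f) :=
    Finsupp.mapRange_injective _ (map_zero f) hf
  have hg' : Function.Surjective (Finsupp.mapRange.linearMap (α := S) g) :=
    Finsupp.mapRange_surjective _ (map_zero g) hg
  refine { exact := ?_, mono_f := ?_, epi_g := ?_ }
  · rw [ShortComplex.ShortExact.moduleCat_exact_iff_function_exact]
    refine LinearMap.exact_iff.2 ?_
    change LinearMap.ker (Finsupp.mapRange.linearMap g) =
      LinearMap.range (Finsupp.mapRange.linearMap f)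
    rw [Finsupp.ker_mapRange, Finsupp.range_mapRange_linearMap f (LinearMap.ker_eq_bot.2 hf),
      hfg.linearMap_ker_eq]
  · exact (ModuleCat.mono_iff_injective _).2 hf'
  · exact (ModuleCat.epi_iff_surjective _).2 hg'

/-- The groups `Ext_B^q(N^{(S)}, Y)` vanish in all degrees `q < m`, for all direct sums `N^{(S)}` of
copies of `N`.  Allowing infinite direct sums makes up for `Ext` being compared on modules that need
not be finitely generated. -/
def ExtVanishesBelow (Y : ModuleCat.{u} B) (m : ℕ) (N : Type u) [AddCommGroup N] [Module B N] :
    Prop :=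
  ∀ (S : Type u), ∀ q < m, ∀ x : Ext (ModuleCat.of B (S →₀ N)) Y q, x = 0


namespace ExtVanishesBelow

variable {Y : ModuleCat.{u} B} {m : ℕ} {N N₁ N₂ N₃ : Type u} [AddCommGroup N] [Module B N]
  [AddCommGroup N₁] [Module B N₁] [AddCommGroup N₂] [Module B N₂] [AddCommGroup N₃] [Module B N₃]

theorem zero : ExtVanishesBelow Y 0 N := fun _ _ hq => absurd hq (Nat.not_lt_zero _)

theorem of_subsingleton [Subsingleton N] : ExtVanishesBelow Y m N := by
  intro S q _ x
  have h : 𝟙 (ModuleCat.of B (S →₀ N)) = 0 := by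
    ext x s
    exact Subsingleton.elim _ _
  rw [← Ext.mk₀_id_comp x, h, Ext.mk₀_zero, Ext.zero_comp]

theorem middle {f : N₁ →ₗ[B] N₂} {g : N₂ →ₗ[B] N₃} (hf : Function.Injective f)
    (hfg : Function.Exact f g) (hg : Function.Surjective g) (h₁ : ExtVanishesBelow Y m N₁)
    (h₃ : ExtVanishesBelow Y m N₃) : ExtVanishesBelow Y m N₂ :=
  fun S q hq => (shortExact_finsupp S f g hf hfg hg).ext_middle_eq_zero (h₁ S q hq) (h₃ S q hq)

theorem right {f : N₁ →ₗ[B] N₂} {g : N₂ →ₗ[B] N₃} (hf : Function.Injective f)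
    (hfg : Function.Exact f g) (hg : Function.Surjective g) (h₁ : ExtVanishesBelow Y m N₁)
    (h₂ : ExtVanishesBelow Y (m + 1) N₂) : ExtVanishesBelow Y (m + 1) N₃
  | S, 0, hq => (shortExact_finsupp S f g hf hfg hg).ext_right_zero_eq_zero (h₂ S 0 hq)
  | S, q + 1, hq => (shortExact_finsupp S f g hf hfg hg).ext_right_succ_eq_zero
      (h₁ S q (by omega)) (h₂ S (q + 1) hq)

/-- The Mayer–Vietoris argument for a sum of two submodules. -/
theorem sup {P Q : Submodule B N} (hP : ExtVanishesBelow Y (m + 1) P)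
    (hQ : ExtVanishesBelow Y (m + 1) Q) (hPQ : ExtVanishesBelow Y m (P ⊓ Q : Submodule B N)) :
    ExtVanishesBelow Y (m + 1) (P ⊔ Q : Submodule B N) := by
  have hprod : ExtVanishesBelow Y (m + 1) (P × Q) :=
    middle (f := LinearMap.inl B P Q) (g := LinearMap.snd B P Q) LinearMap.inl_injective
      Function.Exact.inl_snd LinearMap.snd_surjective hP hQ
  let f : (P ⊓ Q : Submodule B N) →ₗ[B] P × Q :=
    (Submodule.inclusion inf_le_left).prod (-Submodule.inclusion inf_le_right)
  let g : P × Q →ₗ[B] (P ⊔ Q : Submodule B N) :=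
    (Submodule.inclusion le_sup_left).coprod (Submodule.inclusion le_sup_right)
  refine right (f := f) (g := g) ?_ ?_ ?_ hPQ hprod
  · intro x y h
    exact Subtype.ext (congrArg (fun z => (z.1 : N)) h)
  · rintro ⟨p, q⟩
    constructor
    · intro h
      have h' : (p : N) + q = 0 := congrArg Subtype.val h
      have hq : (p : N) = -q := eq_neg_of_add_eq_zero_left h'
      refine ⟨⟨p, p.2, hq ▸ Q.neg_mem q.2⟩, ?_⟩
      refine Prod.ext (Subtype.ext rfl) (Subtype.ext ?_)
      change -(p : N) = q
      rw [hq, neg_neg]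
    · rintro ⟨x, hx⟩
      rw [← hx]
      refine Subtype.ext ?_
      change (x : N) + -(x : N) = 0
      exact add_neg_cancel _
  · rintro ⟨x, hx⟩
    obtain ⟨p, hp, q, hq, rfl⟩ := Submodule.mem_sup.1 hx
    exact ⟨(⟨p, hp⟩, ⟨q, hq⟩), rfl⟩

/-- A left ideal generated by an idempotent that annihilates `Y` has no `Ext` into `Y` at all: it is
projective, and every homomorphism `f` to `Y` satisfies `f e = f (e * e) = e • f e = 0`. -/
theorem span_idempotent {e : B} (he : e * e = e) (hY : ∀ y : Y, e • y = 0) :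
    ExtVanishesBelow Y m (Submodule.span B {e}) := by
  have hmul : ∀ x ∈ Submodule.span B {e}, x * e = x := by
    intro x hx
    obtain ⟨b, rfl⟩ := Submodule.mem_span_singleton.1 hx
    rw [smul_eq_mul, mul_assoc, he]
  have hproj : Module.Projective B (Submodule.span B {e}) := by
    refine Module.Projective.of_split (Submodule.subtype _)
      ((LinearMap.toSpanSingleton B B e).codRestrict _
        fun b => Submodule.mem_span_singleton.2 ⟨b, rfl⟩) ?_
    ext x
    exact hmul x x.2
  intro S q _
  cases q with
  | zero =>
    intro x
    obtain ⟨f, rfl⟩ := (Ext.mk₀_bijective _ _).2 x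
    have hf : f = 0 := by
      refine ModuleCat.hom_ext (Finsupp.lhom_ext fun s x => ?_)
      change f.hom (Finsupp.single s x) = 0
      have hx : x = x.1 • (⟨e, Submodule.mem_span_singleton_self e⟩ : Submodule.span B {e}) :=
        Subtype.ext (hmul x x.2).symm
      have he' : (⟨e, Submodule.mem_span_singleton_self e⟩ : Submodule.span B {e}) =
          e • ⟨e, Submodule.mem_span_singleton_self e⟩ := Subtype.ext he.symm
      rw [hx, ← Finsupp.smul_single, map_smul, he', ← Finsupp.smul_single, map_smul, hY, smul_zero]
    rw [hf, Ext.mk₀_zero]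
  | succ q =>
    have : Module.Projective B (S →₀ Submodule.span B {e}) := by
      classical
      exact Module.Projective.of_equiv (finsuppLequivDFinsupp B).symm
    have := ModuleCat.projective_of_module_projective (ModuleCat.of B (S →₀ Submodule.span B {e}))
    exact fun x => x.eq_zero_of_projective

/-- Dimension shifting along `0 → I → B → B ⧸ I → 0`. -/
theorem quotient {I : Submodule B B} (hI : ExtVanishesBelow Y m I) (S : Type u) (q : ℕ)
    (hq : q < m) (x : Ext (ModuleCat.of B (S →₀ B ⧸ I)) Y (q + 1)) : x = 0 := by
  refine (shortExact_finsupp S I.subtype I.mkQ I.subtype_injective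
    (LinearMap.exact_subtype_mkQ I) I.mkQ_surjective).ext_right_succ_eq_zero (hI S q hq) ?_ x
  have := ModuleCat.projective_of_module_projective (ModuleCat.of B (S →₀ B))
  exact fun x => x.eq_zero_of_projective

end ExtVanishesBelow

end ModuleCat

end

/-! ### Conditions on the left-hand column of a diagram -/

namespace PartitionDiagram

variable {n : ℕ}

theorem stack_left {d₁ : PartitionDiagram n} (d₂ : PartitionDiagram n) {x y : Fin n ⊕ Fin n}
    (h : d₁ x y) : stack d₁ d₂ (leftMiddle x) (leftMiddle y) :=
  (le_sup_left : _ ≤ stack d₁ d₂) (Relation.EqvGen.rel _ _ ⟨x, y, h, rfl, rfl⟩)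

theorem stack_right (d₁ : PartitionDiagram n) {d₂ : PartitionDiagram n} {x y : Fin n ⊕ Fin n}
    (h : d₂ x y) : stack d₁ d₂ (middleRight x) (middleRight y) :=
  (le_sup_right : _ ≤ stack d₁ d₂) (Relation.EqvGen.rel _ _ ⟨x, y, h, rfl, rfl⟩)

/-- A condition on the left-hand column of a diagram: the vertices in `isolated` are components by
themselves, and vertices related by `joined` lie in the same component. -/
structure LeftCondition (n : ℕ) where
  /-- The left-hand vertices required to be components by themselves. -/
  isolated : Finset (Fin n)
  /-- The pairs of left-hand vertices required to lie in the same component. -/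
  joined : Setoid (Fin n)

namespace LeftCondition

/-- The diagrams that satisfy a condition on the left-hand column. -/
def diagrams (c : LeftCondition n) : Set (PartitionDiagram n) :=
  {d | (∀ i j, c.joined i j → d (Sum.inl i) (Sum.inl j)) ∧
    ∀ i ∈ c.isolated, ∀ x, d (Sum.inl i) x → x = Sum.inl i}

/-- The conjunction of two conditions. -/
def and (c c' : LeftCondition n) : LeftCondition n where
  isolated := c.isolated ∪ c'.isolated
  joined := c.joined ⊔ c'.joined

theorem diagrams_and (c c' : LeftCondition n) :
    (c.and c').diagrams = c.diagrams ∩ c'.diagrams := by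
  ext d
  have key : (∀ i j, (c.joined ⊔ c'.joined) i j → d (Sum.inl i) (Sum.inl j)) ↔
      (∀ i j, c.joined i j → d (Sum.inl i) (Sum.inl j)) ∧
        ∀ i j, c'.joined i j → d (Sum.inl i) (Sum.inl j) := by
    constructor
    · exact fun h => ⟨fun i j hij => h i j ((le_sup_left : c.joined ≤ _) hij),
        fun i j hij => h i j ((le_sup_right : c'.joined ≤ _) hij)⟩
    · rintro ⟨h, h'⟩ i j hij
      exact (sup_le (fun i j => h i j) (fun i j => h' i j) :
        c.joined ⊔ c'.joined ≤ d.comap Sum.inl) hij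
  refine (and_congr_left' key).trans ?_
  simp only [diagrams, and, Set.mem_ofPred_eq, Set.mem_inter_iff, Finset.mem_union, or_imp,
    forall_and]
  tauto

theorem comp_mem_diagrams {c : LeftCondition n} {d : PartitionDiagram n} (hd : d ∈ c.diagrams)
    (d' : PartitionDiagram n) : comp d d' ∈ c.diagrams := by
  refine ⟨fun i j hij => stack_left d' (hd.1 i j hij), fun i hi x hx => ?_⟩
  have hle : stack d d' ≤ Setoid.ker (fun x => x = Sum.inl i) := by
    refine sup_le ?_ ?_
    · rw [map_le_iff]
      have aux : ∀ x : Fin n ⊕ Fin n, leftMiddle x = Sum.inl i ↔ x = Sum.inl i := by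
        rintro (x | x) <;> simp [leftMiddle]
      intro x y hxy
      rw [Setoid.comap_rel, Setoid.ker_def, eq_iff_iff, aux, aux]
      constructor
      · rintro rfl
        exact hd.2 i hi y hxy
      · rintro rfl
        exact hd.2 i hi x (d.symm' hxy)
    · rw [map_le_iff]
      intro x y _
      simp [Setoid.ker_def, middleRight]
  have h := hle hx
  rw [Setoid.ker_def, eq_iff_iff] at h
  have h' := h.1 rfl
  rcases x with x | x <;> simp [leftRight] at h'
  rw [h']

/-- The idempotent diagram of a condition.  Left and right vertices `i` outside `isolated` belong to
the component given by the class of `i`; the isolated left-hand vertices are components by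
themselves, while the right-hand vertices opposite to them are attached to the class of `j`.  If `j`
itself is not isolated, this attachment prevents components in the middle column, hence powers of
`δ`, from appearing when the diagram is multiplied on the right. -/
@[reducible] def idempotent (c : LeftCondition n) (j : Fin n) : PartitionDiagram n :=
  Setoid.ker (Sum.elim
    (fun i => if i ∈ c.isolated then Sum.inl i else Sum.inr (Quotient.mk c.joined i))
    (fun i => Sum.inr (Quotient.mk c.joined (if i ∈ c.isolated then j else i))) :
      Fin n ⊕ Fin n → Fin n ⊕ Quotient c.joined)

variable {c : LeftCondition n}

theorem eq_of_joined {d : PartitionDiagram n} (hd : d ∈ c.diagrams) {i i' : Fin n}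
    (hi : i ∈ c.isolated) (h : c.joined i i') : i' = i :=
  Sum.inl_injective (hd.2 i hi _ (hd.1 i i' h))

theorem idempotent_mem {d : PartitionDiagram n} (hd : d ∈ c.diagrams) (j : Fin n) :
    c.idempotent j ∈ c.diagrams := by
  constructor
  · intro i i' h
    by_cases hi : i ∈ c.isolated
    · rw [eq_of_joined hd hi h]
    by_cases hi' : i' ∈ c.isolated
    · rw [eq_of_joined hd hi' (c.joined.symm' h)]
    simpa [Setoid.ker_def, hi, hi'] using Quotient.sound h
  · rintro i hi (i' | i') h
    · by_cases hi' : i' ∈ c.isolated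
      · simpa [Setoid.ker_def, hi, hi', eq_comm] using h
      · simp [Setoid.ker_def, hi, hi'] at h
    · simp [Setoid.ker_def, hi] at h

theorem loops_idempotent {j : Fin n} (hj : j ∉ c.isolated) (d : PartitionDiagram n) :
    loops (c.idempotent j) d = 0 := by
  refine loops_eq_zero _ _ fun i => ⟨Sum.inl (if i ∈ c.isolated then j else i), ?_⟩
  refine stack_left (x := Sum.inl (if i ∈ c.isolated then j else i)) (y := Sum.inr i) d ?_
  by_cases hi : i ∈ c.isolated <;> simp [Setoid.ker_def, hi, hj]

theorem idempotent_comp (j : Fin n) {d : PartitionDiagram n}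
    (hd : d ∈ c.diagrams) : comp (c.idempotent j) d = d := by
  refine le_antisymm ?_ ?_
  · -- collapse the middle column onto the left-hand one, along the idempotent
    let r : Fin n ⊕ Fin n ⊕ Fin n → Fin n ⊕ Fin n :=
      Sum.elim Sum.inl (Sum.map (fun i => if i ∈ c.isolated then j else i) id)
    have hr : ∀ x, r (leftRight x) = x := by
      rintro (x | x) <;> rfl
    have hle : stack (c.idempotent j) d ≤ d.comap r := by
      refine sup_le ?_ ?_
      · rw [map_le_iff]
        rintro (x | x) (y | y) h
        · change d (Sum.inl x) (Sum.inl y)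
          by_cases hx : x ∈ c.isolated <;> by_cases hy : y ∈ c.isolated <;>
            simp [Setoid.ker_def, hx, hy] at h
          · rw [h]
          · exact hd.1 _ _ (Quotient.exact h)
        · change d (Sum.inl x) (Sum.inl (if y ∈ c.isolated then j else y))
          by_cases hx : x ∈ c.isolated <;> simp [Setoid.ker_def, hx] at h
          exact hd.1 _ _ (Quotient.exact h)
        · change d (Sum.inl (if x ∈ c.isolated then j else x)) (Sum.inl y)
          by_cases hy : y ∈ c.isolated <;> simp [Setoid.ker_def, hy] at h
          exact hd.1 _ _ (Quotient.exact h)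
        · change d (Sum.inl (if x ∈ c.isolated then j else x))
            (Sum.inl (if y ∈ c.isolated then j else y))
          simp [Setoid.ker_def] at h
          exact hd.1 _ _ (Quotient.exact h)
      · rw [map_le_iff]
        have aux : ∀ x y, d x y → x = y ∨ r (middleRight x) = x := by
          rintro (x | x) y h
          · by_cases hx : x ∈ c.isolated
            · exact Or.inl (hd.2 x hx y h).symm
            · exact Or.inr (by simp [r, middleRight, hx])
          · exact Or.inr rfl
        intro x y h
        rw [Setoid.comap_rel, Setoid.comap_rel]
        rcases aux x y h with rfl | hx
        · exact d.refl' _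
        rcases aux y x (d.symm' h) with rfl | hy
        · exact d.refl' _
        rwa [hx, hy]
    intro x y h
    have := hle h
    rwa [Setoid.comap_rel, hr, hr] at this
  · set T := stack (c.idempotent j) d
    have aux : ∀ x y, d x y → x = y ∨ T (leftRight x) (middleRight x) := by
      rintro (x | x) y h
      · by_cases hx : x ∈ c.isolated
        · exact Or.inl (hd.2 x hx y h).symm
        · refine Or.inr (stack_left (x := Sum.inl x) (y := Sum.inr x) d ?_)
          simp [Setoid.ker_def, hx]
      · exact Or.inr (T.refl' _)
    intro x y h
    rcases aux x y h with rfl | hx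
    · exact T.refl' _
    rcases aux y x (d.symm' h) with rfl | hy
    · exact T.refl' _
    exact T.trans' hx (T.trans' (stack_right _ h) (T.symm' hy))

/-- The condition that the left-hand vertex `i` is a component by itself. -/
def isolate (i : Fin n) : LeftCondition n := ⟨{i}, ⊥⟩

/-- The condition that the left-hand vertices `i` and `j` lie in the same component. -/
def join (i j : Fin n) : LeftCondition n :=
  ⟨∅, Relation.EqvGen.setoid fun a b => a = i ∧ b = j⟩

theorem mem_diagrams_isolate {i : Fin n} {d : PartitionDiagram n} :
    d ∈ (isolate i).diagrams ↔ ∀ x, d (Sum.inl i) x → x = Sum.inl i := by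
  simp only [diagrams, isolate, Set.mem_ofPred_eq, Finset.mem_singleton, forall_eq]
  refine and_iff_right ?_
  rintro i j rfl
  exact d.refl' _

theorem mem_diagrams_join {i j : Fin n} {d : PartitionDiagram n} :
    d ∈ (join i j).diagrams ↔ d (Sum.inl i) (Sum.inl j) := by
  constructor
  · exact fun h => h.1 i j (Relation.EqvGen.rel _ _ ⟨rfl, rfl⟩)
  · refine fun h => ⟨fun a b hab => ?_, fun _ hi => absurd hi (Finset.notMem_empty _)⟩
    have hle : Relation.EqvGen.setoid (fun a b => a = i ∧ b = j) ≤ d.comap Sum.inl :=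
      Setoid.eqvGen_le (by rintro _ _ ⟨rfl, rfl⟩; exact h)
    exact hle hab

open Classical in
/-- The basic conditions: some vertex is isolated, or two different vertices are joined. -/
noncomputable def basic (n : ℕ) : List (LeftCondition n) :=
  (Finset.univ.image (isolate (n := n)) ∪
    (Finset.univ.filter fun p : Fin n × Fin n => p.1 ≠ p.2).image fun p => join p.1 p.2).toList

theorem mem_basic {c : LeftCondition n} :
    c ∈ basic n ↔ (∃ i, isolate i = c) ∨ ∃ i j, i ≠ j ∧ join i j = c := by
  simp [basic]

theorem card_isolated_le_one {c : LeftCondition n} (hc : c ∈ basic n) : c.isolated.card ≤ 1 := by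
  rcases mem_basic.1 hc with ⟨i, rfl⟩ | ⟨i, j, _, rfl⟩ <;> simp [isolate, join]

/-- A diagram fails to be a permutation diagram if and only if, in its left-hand column, some vertex
is isolated or two vertices are joined. -/
theorem not_isPermutation_iff (d : PartitionDiagram n) :
    ¬ d.IsPermutation ↔ ∃ c ∈ basic n, d ∈ c.diagrams := by
  rw [isPermutation_iff']
  constructor
  · intro h
    by_cases h₁ : ∃ i j, i ≠ j ∧ d (Sum.inl i) (Sum.inl j)
    · obtain ⟨i, j, hij, hd⟩ := h₁
      exact ⟨join i j, mem_basic.2 (Or.inr ⟨i, j, hij, rfl⟩), mem_diagrams_join.2 hd⟩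
    · have h₁' : ∀ i j, d (Sum.inl i) (Sum.inl j) → i = j := fun i j hd => by
        by_contra hij
        exact h₁ ⟨i, j, hij, hd⟩
      have h₂ : ∃ i, ∀ j, ¬ d (Sum.inr j) (Sum.inl i) := by
        by_contra h₂
        push Not at h₂
        exact h ⟨h₁', h₂⟩
      obtain ⟨i, hi⟩ := h₂
      refine ⟨isolate i, mem_basic.2 (Or.inl ⟨i, rfl⟩), mem_diagrams_isolate.2 ?_⟩
      rintro (x | x) hx
      · rw [h₁' i x hx]
      · exact absurd (d.symm' hx) (hi x)
  · rintro ⟨c, hc, hd⟩ ⟨h₁, h₂⟩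
    rcases mem_basic.1 hc with ⟨i, rfl⟩ | ⟨i, j, hij, rfl⟩
    · obtain ⟨j, hj⟩ := h₂ i
      have := mem_diagrams_isolate.1 hd _ (d.symm' hj)
      simp at this
    · exact hij (h₁ i j (mem_diagrams_join.1 hd))

end LeftCondition

end PartitionDiagram

/-! ### The ideal of non-permutation diagrams -/

section

open CategoryTheory

namespace PartitionAlgebra

open PartitionDiagram MulOpposite

variable {k : Type u} [CommRing k] (δ : k) {n : ℕ}

theorem rightAugmentation_diagram {d : PartitionDiagram n} (hd : ¬ d.IsPermutation) :
    rightAugmentation δ n (op (diagramBasis δ n d)) = 0 :=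
  (augmentationLinear_diagram δ n d).trans (if_neg hd)

/-- The right ideal of the partition algebra generated by a set of diagrams, as a left ideal of the
opposite algebra. -/
noncomputable def diagramSpan (D : Set (PartitionDiagram n)) :
    Submodule (PartitionAlgebra k δ n)ᵐᵒᵖ (PartitionAlgebra k δ n)ᵐᵒᵖ :=
  Submodule.span _ ((fun d => op (diagramBasis δ n d)) '' D)

theorem diagram_mem_diagramSpan {D : Set (PartitionDiagram n)} {d : PartitionDiagram n}
    (hd : d ∈ D) : op (diagramBasis δ n d) ∈ diagramSpan δ D :=
  Submodule.subset_span ⟨d, hd, rfl⟩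

theorem diagramSpan_union (D E : Set (PartitionDiagram n)) :
    diagramSpan δ (D ∪ E) = diagramSpan δ D ⊔ diagramSpan δ E := by
  rw [diagramSpan, Set.image_union, Submodule.span_union]
  rfl

theorem diagramSpan_empty : diagramSpan δ (∅ : Set (PartitionDiagram n)) = ⊥ := by
  rw [diagramSpan, Set.image_empty, Submodule.span_empty]

/-- If a set of diagrams is stable under composition on the right, then the right ideal it generates
has this set as a basis. -/
theorem mem_diagramSpan {D : Set (PartitionDiagram n)} (hD : ∀ d ∈ D, ∀ d', comp d d' ∈ D)
    (x : (PartitionAlgebra k δ n)ᵐᵒᵖ) :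
    x ∈ diagramSpan δ D ↔ ↑((diagramBasis δ n).repr (unop x)).support ⊆ D := by
  rw [← Module.Basis.mem_span_image]
  constructor
  · intro hx
    induction hx using Submodule.span_induction with
    | mem x hx =>
      obtain ⟨d, hd, rfl⟩ := hx
      exact Submodule.subset_span ⟨d, hd, rfl⟩
    | zero => exact zero_mem _
    | add x y _ _ hx hy => exact add_mem hx hy
    | smul b x _ hx =>
      change unop x * unop b ∈ _
      generalize unop x = x at hx
      generalize unop b = b
      induction b using induction_diagram with
      | zero => rw [mul_zero]; exact zero_mem _
      | add b b' hb hb' => rw [mul_add]; exact add_mem hb hb'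
      | smul a d' =>
        induction hx using Submodule.span_induction with
        | mem x hx =>
          obtain ⟨d, hd, rfl⟩ := hx
          rw [mul_smul', diagram_mul]
          exact Submodule.smul_mem _ _ (Submodule.smul_mem _ _
            (Submodule.subset_span ⟨_, hD d hd d', rfl⟩))
        | zero => rw [zero_mul]; exact zero_mem _
        | add x y _ _ hx hy => rw [add_mul]; exact add_mem hx hy
        | smul r x _ hx => rw [smul_mul']; exact Submodule.smul_mem _ _ hx
  · intro hx
    rw [← op_unop x]
    generalize unop x = x at hx
    induction hx using Submodule.span_induction with
    | mem x hx =>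
      obtain ⟨d, hd, rfl⟩ := hx
      exact diagram_mem_diagramSpan δ hd
    | zero => exact zero_mem _
    | add x y _ _ hx hy => exact add_mem hx hy
    | smul r x _ hx =>
      have : op (r • x) = algebraMap k (PartitionAlgebra k δ n)ᵐᵒᵖ r • op x := by
        rw [algebraMap_smul, op_smul]
      rw [this]
      exact Submodule.smul_mem _ _ hx

theorem diagramSpan_inter {D E : Set (PartitionDiagram n)} (hD : ∀ d ∈ D, ∀ d', comp d d' ∈ D)
    (hE : ∀ d ∈ E, ∀ d', comp d d' ∈ E) :
    diagramSpan δ (D ∩ E) = diagramSpan δ D ⊓ diagramSpan δ E := by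
  ext x
  rw [Submodule.mem_inf, mem_diagramSpan δ hD, mem_diagramSpan δ hE,
    mem_diagramSpan δ (D := D ∩ E) fun d hd d' => ⟨hD d hd.1 d', hE d hd.2 d'⟩,
    Set.subset_inter_iff]

/-- The trivial right module of the partition algebra. -/
noncomputable abbrev trivialModule (n : ℕ) : ModuleCat.{u} (PartitionAlgebra k δ n)ᵐᵒᵖ :=
  AugmentedAlgebra.trivialModule (rightAugmentation δ n)

theorem smul_trivialModule_eq_zero {d : PartitionDiagram n} (hd : ¬ d.IsPermutation)
    (y : trivialModule δ n) : op (diagramBasis δ n d) • y = 0 :=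
  (congrArg (fun a : k => a * (show k from y)) (rightAugmentation_diagram δ hd)).trans (zero_mul _)

open LeftCondition

/-- As long as some left-hand vertex is not required to be isolated, the right ideal of a condition
is zero or generated by an idempotent. -/
theorem extVanishesBelow_diagrams {c : LeftCondition n} (hc : c.isolated.card < n)
    (hperm : ∀ d ∈ c.diagrams, ¬ d.IsPermutation) (m : ℕ) :
    ExtVanishesBelow (trivialModule δ n) m (diagramSpan δ c.diagrams) := by
  rcases c.diagrams.eq_empty_or_nonempty with h | ⟨d₀, hd₀⟩
  · rw [h, diagramSpan_empty]
    exact .of_subsingleton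
  obtain ⟨j, hj⟩ : ∃ j, j ∉ c.isolated := by
    by_contra! h
    rw [Finset.eq_univ_of_forall h, Finset.card_univ, Fintype.card_fin] at hc
    exact hc.false
  have hmem := idempotent_mem hd₀ j
  have hmul : ∀ d ∈ c.diagrams, diagramBasis δ n (c.idempotent j) * diagramBasis δ n d =
      diagramBasis δ n d := by
    intro d hd
    rw [diagram_mul, loops_idempotent hj, idempotent_comp j hd, pow_zero, one_smul]
  have hspan : diagramSpan δ c.diagrams =
      Submodule.span _ {op (diagramBasis δ n (c.idempotent j))} := by
    refine le_antisymm (Submodule.span_le.2 ?_) ?_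
    · rintro _ ⟨d, hd, rfl⟩
      refine Submodule.mem_span_singleton.2 ⟨op (diagramBasis δ n d), ?_⟩
      rw [smul_eq_mul, ← op_mul, hmul d hd]
    · rw [Submodule.span_singleton_le_iff_mem]
      exact diagram_mem_diagramSpan δ hmem
  rw [hspan]
  refine .span_idempotent ?_ (smul_trivialModule_eq_zero δ (hperm _ hmem))
  rw [← op_mul, hmul _ hmem]

/-- The diagrams satisfying `c₀` and at least one of the conditions in `L`. -/
def diagramsUnion (c₀ : LeftCondition n) (L : List (LeftCondition n)) :
    Set (PartitionDiagram n) :=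
  {d | d ∈ c₀.diagrams ∧ ∃ c ∈ L, d ∈ c.diagrams}

theorem comp_mem_diagramsUnion {c₀ : LeftCondition n} {L : List (LeftCondition n)} :
    ∀ d ∈ diagramsUnion c₀ L, ∀ d', comp d d' ∈ diagramsUnion c₀ L :=
  fun _ hd d' => ⟨comp_mem_diagrams hd.1 d',
    let ⟨c, hc, hdc⟩ := hd.2
    ⟨c, hc, comp_mem_diagrams hdc d'⟩⟩

/-- Repeated Mayer–Vietoris.  The ideal of the diagrams satisfying `c₀` and one of a list of basic
conditions has no `Ext` into the trivial module in degrees less than `m`, as long as `m` further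
vertices can be isolated without all vertices being isolated: each intersection in the
Mayer–Vietoris sequences lowers the degree by one and isolates at most one more vertex. -/
theorem extVanishesBelow_diagramsUnion (L : List (LeftCondition n)) (hL : ∀ c ∈ L, c ∈ basic n)
    (c₀ : LeftCondition n) (m : ℕ) (hm : c₀.isolated.card + m < n) :
    ExtVanishesBelow (trivialModule δ n) m (diagramSpan δ (diagramsUnion c₀ L)) := by
  induction L generalizing c₀ m with
  | nil =>
    have : diagramsUnion c₀ [] = ∅ := by simp [diagramsUnion]
    rw [this, diagramSpan_empty]
    exact .of_subsingleton
  | cons c L ih =>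
    cases m with
    | zero => exact .zero
    | succ m =>
      have hc := hL c List.mem_cons_self
      have hL' : ∀ c' ∈ L, c' ∈ basic n := fun c' hc' => hL c' (List.mem_cons_of_mem c hc')
      have hcard : (c₀.and c).isolated.card ≤ c₀.isolated.card + 1 :=
        (Finset.card_union_le _ _).trans (Nat.add_le_add_left (card_isolated_le_one hc) _)
      have hunion : diagramsUnion c₀ (c :: L) =
          (c₀.and c).diagrams ∪ diagramsUnion c₀ L := by
        ext d
        simp only [diagramsUnion, diagrams_and, List.mem_cons, Set.mem_ofPred_eq, Set.mem_union,
          Set.mem_inter_iff, or_and_right, exists_or, exists_eq_left, and_or_left]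
      have hinter : (c₀.and c).diagrams ∩ diagramsUnion c₀ L = diagramsUnion (c₀.and c) L := by
        ext d
        simp only [diagramsUnion, diagrams_and, Set.mem_ofPred_eq, Set.mem_inter_iff]
        tauto
      rw [hunion, diagramSpan_union]
      refine .sup ?_ (ih hL' c₀ (m + 1) hm) ?_
      · refine extVanishesBelow_diagrams δ (by omega) (fun d hd => ?_) _
        rw [diagrams_and] at hd
        exact (not_isPermutation_iff d).2 ⟨c, hc, hd.2⟩
      · rw [← diagramSpan_inter δ (fun d hd d' => comp_mem_diagrams hd d') comp_mem_diagramsUnion,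
          hinter]
        exact ih hL' _ m (by omega)

variable (n) in
/-- The ideal spanned by the diagrams that are not permutation diagrams. -/
noncomputable abbrev nonPermutationIdeal :
    Submodule (PartitionAlgebra k δ n)ᵐᵒᵖ (PartitionAlgebra k δ n)ᵐᵒᵖ :=
  diagramSpan δ {d | ¬ d.IsPermutation}

theorem extVanishesBelow_nonPermutationIdeal {m : ℕ} (hm : m < n) :
    ExtVanishesBelow (trivialModule δ n) m (nonPermutationIdeal δ n) := by
  have h : {d : PartitionDiagram n | ¬ d.IsPermutation} = diagramsUnion ⟨∅, ⊥⟩ (basic n) := by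
    ext d
    refine (not_isPermutation_iff d).trans (and_iff_right ?_).symm
    refine ⟨?_, fun _ hi => absurd hi (Finset.notMem_empty _)⟩
    rintro i j rfl
    exact d.refl' _
  rw [nonPermutationIdeal, h]
  exact extVanishesBelow_diagramsUnion δ _ (fun _ hc => hc) _ m (by simpa using hm)

end PartitionAlgebra

end

/-! ### Modules inflated from the symmetric group -/

section

open CategoryTheory

theorem PartitionDiagram.ofPerm_injective {n : ℕ} :
    Function.Injective (PartitionDiagram.ofPerm (n := n)) := by
  intro σ τ h
  ext i
  have h' : PartitionDiagram.ofPerm σ (Sum.inr i) (Sum.inl (τ i)) := by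
    rw [h]
    rfl
  exact congrArg Fin.val h'

open scoped MonoidAlgebra ModuleCat.Algebra in
/-- An additive isomorphism from a free representation to an `A`-module that is compatible with the
actions of `k` and `G`, as an isomorphism of representations. -/
noncomputable def AugmentedAlgebra.freeIsoToRep {k : Type u} [CommRing k] {A : Type u} [Ring A]
    [Algebra k A] {G : Type u} [Group G] (φ : G →* A) (S : Type u) (N : ModuleCat.{u} A)
    (f : (S →₀ k[G]) ≃+ N) (hk : ∀ (r : k) x, f (r • x) = algebraMap k A r • f x)
    (hG : ∀ (g : G) x, f (Representation.free k G S g x) = φ g • f x) :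
    Rep.free k G S ≅ (toRep (k := k) φ).obj N :=
  Rep.mkIso
    { f with
      map_smul' := hk
      isIntertwining' := fun g => LinearMap.ext (hG g) }

open scoped MonoidAlgebra in
/-- If `M` is free of rank one over the group algebra, then direct sums of copies of `M` are
projective representations. -/
theorem AugmentedAlgebra.projective_toRep {k : Type u} [CommRing k] {A : Type u} [Ring A]
    [Algebra k A] {G : Type u} [Group G] (φ : G →* A) {M : Type u} [AddCommGroup M] [Module A M]
    (m : M) (hm : Function.Bijective fun y : k[G] => MonoidAlgebra.lift k A G φ y • m)
    (S : Type u) : Projective ((toRep (k := k) φ).obj (ModuleCat.of A (S →₀ M))) := by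
  let v : k[G] →+ M :=
    { toFun := fun y => MonoidAlgebra.lift k A G φ y • m
      map_zero' := by rw [map_zero, zero_smul]
      map_add' := fun y y' => by rw [map_add, add_smul] }
  have hv : ∀ y, v y = MonoidAlgebra.lift k A G φ y • m := fun _ => rfl
  let f : (S →₀ k[G]) →+ (S →₀ M) := Finsupp.mapRange.addMonoidHom v
  have hf : ∀ s y, f (Finsupp.single s y) = Finsupp.single s (v y) :=
    fun s y => Finsupp.mapRange_single (hf := map_zero v)
  have hsmul : ∀ (r : k) x, f (r • x) = algebraMap k A r • f x := by
    intro r x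
    induction x using Finsupp.induction_linear with
    | zero => rw [smul_zero, map_zero, smul_zero]
    | add x y hx hy => rw [smul_add, map_add, map_add, hx, hy, smul_add]
    | single s y =>
      rw [Finsupp.smul_single, hf, hf, Finsupp.smul_single, hv, hv, map_smul, Algebra.smul_def,
        mul_smul]
  have hG : ∀ (g : G) x, f (Representation.free k G S g x) = φ g • f x := by
    intro g x
    induction x using Finsupp.induction_linear with
    | zero => rw [map_zero, map_zero, smul_zero]
    | add x y hx hy => rw [map_add, map_add, map_add, hx, hy, smul_add]
    | single s y =>
      induction y using MonoidAlgebra.induction_linear with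
      | zero => rw [Finsupp.single_zero, map_zero, map_zero, smul_zero]
      | add y y' hy hy' => rw [Finsupp.single_add, map_add, map_add, map_add, hy, hy', smul_add]
      | single h r =>
        rw [Representation.free_single_single, hf, hf, hv, hv, Finsupp.smul_single,
          MonoidAlgebra.lift_single, MonoidAlgebra.lift_single, map_mul, smul_smul, mul_smul_comm]
  have hbij : Function.Bijective f :=
    ⟨Finsupp.mapRange_injective v (map_zero v) hm.1,
      Finsupp.mapRange_surjective v (map_zero v) hm.2⟩
  exact Projective.of_iso
    (freeIsoToRep φ S (ModuleCat.of A (S →₀ M)) (AddEquiv.ofBijective f hbij) hsmul hG)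
    inferInstance

namespace PartitionAlgebra

open PartitionDiagram MulOpposite

variable {k : Type u} [CommRing k] (δ : k) {n : ℕ}

theorem permHomRight_inv (σ : Equiv.Perm (Fin n)) :
    permHomRight δ n ⟨σ⁻¹⟩ = op (diagramBasis δ n (ofPerm σ)) := by
  change op (permHom δ n σ⁻¹⁻¹) = _
  rw [inv_inv]
  rfl

/-- Every element of the opposite partition algebra is a sum of multiples of diagrams; here the
permutation diagrams are presented as elements of the symmetric group. -/
theorem induction_permHomRight {p : (PartitionAlgebra k δ n)ᵐᵒᵖ → Prop}
    (x : (PartitionAlgebra k δ n)ᵐᵒᵖ) (zero : p 0) (add : ∀ x y, p x → p y → p (x + y))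
    (perm : ∀ (a : k) g, p (algebraMap k _ a * permHomRight δ n g))
    (diagram : ∀ (a : k) (d : PartitionDiagram n), ¬ d.IsPermutation →
      p (algebraMap k _ a * op (diagramBasis δ n d))) : p x := by
  rw [← op_unop x]
  generalize unop x = x
  induction x using induction_diagram with
  | zero => exact zero
  | add x y hx hy => exact add _ _ hx hy
  | smul a d =>
    rw [op_smul, Algebra.smul_def]
    by_cases hd : d.IsPermutation
    · obtain ⟨σ, rfl⟩ := (isPermutation_iff d).1 hd
      rw [← permHomRight_inv]
      exact perm a _
    · exact diagram a d hd

/-- The modules on which all diagrams other than permutation diagrams act by zero, that is, the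
modules that come from the group algebra of the symmetric group. -/
def IsInflated (X : ModuleCat.{u} (PartitionAlgebra k δ n)ᵐᵒᵖ) : Prop :=
  ∀ d : PartitionDiagram n, ¬ d.IsPermutation → ∀ x : X, op (diagramBasis δ n d) • x = 0

/-- Between inflated modules, linearity over the partition algebra is equivariance under the
symmetric group. -/
theorem toRep_map_bijective {X Y : ModuleCat.{u} (PartitionAlgebra k δ n)ᵐᵒᵖ}
    (hX : IsInflated δ X) (hY : IsInflated δ Y) : Function.Bijective
      ((AugmentedAlgebra.toRep (k := k) (permHomRight.{u} δ n)).map :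
        (X ⟶ Y) → ((AugmentedAlgebra.toRep (k := k) (permHomRight.{u} δ n)).obj X ⟶
          (AugmentedAlgebra.toRep (k := k) (permHomRight.{u} δ n)).obj Y)) := by
  constructor
  · intro f g h
    ext x
    exact congrArg (fun a => a.hom x) h
  · intro f
    let f' : X → Y := fun x => f.hom x
    have hadd : ∀ x y, f' (x + y) = f' x + f' y := fun x y => map_add f.hom x y
    have hk : ∀ (a : k) x, f' (algebraMap k (PartitionAlgebra k δ n)ᵐᵒᵖ a • x) =
        algebraMap k (PartitionAlgebra k δ n)ᵐᵒᵖ a • f' x :=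
      fun a x => f.hom.toLinearMap.map_smul a x
    have hG : ∀ (g : SymmetricGroup.{u} n) x, f' (permHomRight δ n g • x) =
        permHomRight δ n g • f' x := fun g x => LinearMap.congr_fun (f.hom.isIntertwining' g) x
    have hzero : f' 0 = 0 := map_zero f.hom
    refine ⟨ModuleCat.ofHom { toFun := f', map_add' := hadd, map_smul' := fun b => ?_ }, rfl⟩
    induction b using induction_permHomRight with
    | zero => intro x; simp [hzero]
    | add b b' hb hb' =>
      intro x
      rw [add_smul, hadd, hb, hb', RingHom.id_apply, RingHom.id_apply, RingHom.id_apply, add_smul]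
    | perm a g =>
      intro x
      rw [RingHom.id_apply, mul_smul, mul_smul, hk, hG]
    | diagram a d hd =>
      intro x
      rw [RingHom.id_apply, mul_smul, mul_smul, hX d hd, hY d hd, smul_zero, smul_zero, hzero]

theorem isInflated_trivialModule : IsInflated δ (trivialModule δ n) :=
  fun _ hd y => smul_trivialModule_eq_zero δ hd y

theorem comp_mem_nonPermutation (d : PartitionDiagram n) (hd : ¬ d.IsPermutation)
    (d' : PartitionDiagram n) : ¬ (comp d d').IsPermutation :=
  fun h => hd (isPermutation_of_comp h).1

theorem diagram_mul_mem_nonPermutationIdeal {d : PartitionDiagram n} (hd : ¬ d.IsPermutation)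
    (b : (PartitionAlgebra k δ n)ᵐᵒᵖ) :
    op (diagramBasis δ n d) * b ∈ nonPermutationIdeal δ n := by
  rw [← op_unop b]
  generalize unop b = b
  induction b using induction_diagram with
  | zero => rw [op_zero, mul_zero]; exact zero_mem _
  | add b b' hb hb' => rw [MulOpposite.op_add, mul_add]; exact add_mem hb hb'
  | smul a d' =>
    rw [← op_mul, smul_mul', diagram_mul, op_smul, op_smul]
    refine Submodule.smul_of_tower_mem _ _ (Submodule.smul_of_tower_mem _ _ ?_)
    exact diagram_mem_diagramSpan δ fun h => hd (isPermutation_of_comp h).2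

variable (n) in
/-- The direct sum, indexed by `S`, of copies of the group algebra of the symmetric group, as a
module over the partition algebra. -/
noncomputable abbrev inflatedFree (S : Type u) : ModuleCat.{u} (PartitionAlgebra k δ n)ᵐᵒᵖ :=
  ModuleCat.of _ (S →₀ (PartitionAlgebra k δ n)ᵐᵒᵖ ⧸ nonPermutationIdeal δ n)

theorem isInflated_inflatedFree (S : Type u) : IsInflated δ (inflatedFree δ n S) := by
  intro d hd x
  refine Finsupp.ext fun s => ?_
  obtain ⟨b, hb⟩ := Submodule.mkQ_surjective (nonPermutationIdeal δ n)
    ((show S →₀ (PartitionAlgebra k δ n)ᵐᵒᵖ ⧸ nonPermutationIdeal δ n from x) s)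
  change op (diagramBasis δ n d) • (show S →₀ _ from x) s = 0
  rw [← hb, ← map_smul, Submodule.mkQ_apply, Submodule.Quotient.mk_eq_zero]
  exact diagram_mul_mem_nonPermutationIdeal δ hd b

open scoped MonoidAlgebra

/-- The coefficients of permutation diagrams recover an element of the group algebra from its image
in the partition algebra. -/
theorem repr_lift_permHomRight (y : k[SymmetricGroup.{u} n]) (σ : Equiv.Perm (Fin n)) :
    (diagramBasis δ n).repr (unop (MonoidAlgebra.lift k _ _ (permHomRight.{u} δ n) y)) (ofPerm σ) =
      y.coeff ⟨σ⁻¹⟩ := by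
  classical
  induction y using MonoidAlgebra.induction_linear with
  | zero => simp
  | add y y' hy hy' =>
    simp only [map_add, MulOpposite.unop_add, Finsupp.add_apply, hy, hy', MonoidAlgebra.coeff_add]
  | single g r =>
    obtain ⟨τ, rfl⟩ : ∃ τ : Equiv.Perm (Fin n), g = ⟨τ⁻¹⟩ := ⟨g.down⁻¹, by rw [inv_inv]⟩
    rw [MonoidAlgebra.lift_single, permHomRight_inv, ← op_smul, unop_op, map_smul,
      Module.Basis.repr_self, MonoidAlgebra.coeff_single]
    simp [Finsupp.single_apply, ofPerm_injective.eq_iff]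

/-- As a module over `k[Σ_n]`, the quotient by the ideal of non-permutation diagrams is `k[Σ_n]`. -/
theorem mkQ_comp_lift_bijective : Function.Bijective
    fun y => (nonPermutationIdeal δ n).mkQ
      (MonoidAlgebra.lift k _ _ (permHomRight.{u} δ n) y) := by
  constructor
  · intro y y' h
    rw [← sub_eq_zero]
    replace h : (nonPermutationIdeal δ n).mkQ
        (MonoidAlgebra.lift k _ _ (permHomRight.{u} δ n) (y - y')) = 0 := by
      rw [map_sub, map_sub, sub_eq_zero]
      exact h
    generalize y - y' = y at h
    rw [Submodule.mkQ_apply, Submodule.Quotient.mk_eq_zero,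
      mem_diagramSpan δ (D := {d | ¬ d.IsPermutation}) comp_mem_nonPermutation] at h
    ext ⟨g⟩
    have hg : ofPerm g⁻¹ ∉ _ := fun hmem => h hmem (isPermutation_ofPerm g⁻¹)
    have := repr_lift_permHomRight δ y g⁻¹
    rw [inv_inv, Finsupp.notMem_support_iff.1 hg] at this
    exact this.symm
  · intro z
    obtain ⟨b, rfl⟩ := Submodule.mkQ_surjective _ z
    induction b using induction_permHomRight with
    | zero => exact ⟨0, by simp⟩
    | add b b' hb hb' =>
      obtain ⟨y, hy⟩ := hb
      obtain ⟨y', hy'⟩ := hb'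
      exact ⟨y + y', by simp only [map_add] at hy hy' ⊢; rw [hy, hy']⟩
    | perm a g =>
      refine ⟨MonoidAlgebra.single g a, ?_⟩
      simp only [MonoidAlgebra.lift_single, Algebra.smul_def]
    | diagram a d hd =>
      refine ⟨0, ?_⟩
      simp only [map_zero]
      refine ((Submodule.Quotient.mk_eq_zero _).2 ?_).symm
      exact Submodule.smul_mem _ _ (diagram_mem_diagramSpan δ hd)

theorem projective_toRep_inflatedFree (S : Type u) :
    Projective ((AugmentedAlgebra.toRep (k := k) (permHomRight.{u} δ n)).obj
      (inflatedFree δ n S)) := by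
  refine AugmentedAlgebra.projective_toRep (permHomRight.{u} δ n) (Submodule.mkQ _ 1) ?_ S
  simp_rw [← map_smul, smul_eq_mul, mul_one]
  exact mkQ_comp_lift_bijective δ

/-- The canonical presentation of an inflated module by a direct sum of copies of the group
algebra, with one copy for each element. -/
theorem exists_inflated_presentation {X : ModuleCat.{u} (PartitionAlgebra k δ n)ᵐᵒᵖ}
    (hX : IsInflated δ X) : ∃ S : ShortComplex (ModuleCat.{u} (PartitionAlgebra k δ n)ᵐᵒᵖ),
      S.ShortExact ∧ S.X₃ = X ∧ IsInflated δ S.X₁ ∧ S.X₂ = inflatedFree δ n X := by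
  have hker : ∀ x : X, nonPermutationIdeal δ n ≤
      LinearMap.ker (LinearMap.toSpanSingleton (PartitionAlgebra k δ n)ᵐᵒᵖ X x) := by
    intro x
    refine Submodule.span_le.2 ?_
    rintro _ ⟨d, hd, rfl⟩
    exact hX d hd x
  let p : (X →₀ (PartitionAlgebra k δ n)ᵐᵒᵖ ⧸ nonPermutationIdeal δ n) →ₗ[_] X :=
    Finsupp.lsum ℕ fun x => Submodule.liftQ _ _ (hker x)
  have hp : Function.Surjective p := fun x => ⟨Finsupp.single x (Submodule.mkQ _ 1), by simp [p]⟩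
  let i : ModuleCat.of _ (LinearMap.ker p) ⟶ inflatedFree δ n X :=
    ModuleCat.ofHom (LinearMap.ker p).subtype
  refine ⟨ShortComplex.mk i (ModuleCat.ofHom p) (ModuleCat.hom_ext (LinearMap.ext fun x => x.2)),
    ?_, rfl, ?_, rfl⟩
  · refine { exact := ?_, mono_f := ?_, epi_g := ?_ }
    · rw [ShortComplex.ShortExact.moduleCat_exact_iff_function_exact]
      exact LinearMap.exact_subtype_ker_map p
    · exact (ModuleCat.mono_iff_injective _).2 (Submodule.subtype_injective _)
    · exact (ModuleCat.epi_iff_surjective _).2 hp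
  · exact fun d hd x => Subtype.ext (isInflated_inflatedFree δ X d hd x.1)

/-- Restriction to the symmetric group is bijective in degrees `q < n` on `Ext` from an inflated
module to the trivial module. -/
theorem mapExt_toRep_bijective {q : ℕ} (hq : q < n)
    {X : ModuleCat.{u} (PartitionAlgebra k δ n)ᵐᵒᵖ} (hX : IsInflated δ X) :
    Function.Bijective ((AugmentedAlgebra.toRep (k := k) (permHomRight.{u} δ n)).mapExtAddHom X
      (trivialModule δ n) q) := by
  refine mapExt_bijective_of_resolving _ (IsInflated δ) _ q (fun X hX => ?_)
    (fun X hX => toRep_map_bijective δ hX (isInflated_trivialModule δ)) q le_rfl X hX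
  obtain ⟨S, hS, h₃, h₁, h₂⟩ := exists_inflated_presentation δ hX
  refine ⟨S, hS, h₃, h₁, ?_, ?_, ?_⟩
  · rw [h₂]
    exact isInflated_inflatedFree δ X
  · rw [h₂]
    exact fun p hp => (extVanishesBelow_nonPermutationIdeal δ hq).quotient X p hp
  · rw [h₂]
    have := projective_toRep_inflatedFree δ (n := n) X
    exact fun p _ x => x.eq_zero_of_projective

end PartitionAlgebra

end

/-! ### Group cohomology as `Ext` -/

section

open CategoryTheory

namespace CategoryTheory.ProjectiveResolution

open Abelian CochainComplex HomComplex

variable {C : Type*} [Category C] [Abelian C] [HasExt C] {X Y : C} (R : ProjectiveResolution X)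

/-- In degree zero there are no coboundaries: the resolution, as a cochain complex, vanishes in
degree `1`. -/
theorem extMk_zero_degree_eq_zero_iff (f : R.complex.X 0 ⟶ Y) (hf : R.complex.d 1 0 ≫ f = 0) :
    R.extMk f 1 rfl hf = 0 ↔ f = 0 := by
  simp only [← R.extEquivCohomologyClass.apply_eq_iff_eq, extEquivCohomologyClass_extMk,
    extEquivCohomologyClass_zero, CohomologyClass.mk_eq_zero_iff]
  rw [Cocycle.toSingleMk_mem_coboundaries_iff _ _ _ _ _ 1 (by simp)]
  have hX : Limits.IsZero (R.cochainComplex.X 1) :=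
    R.cochainComplex.isZero_of_isStrictlyLE 0 1 (by simp)
  constructor
  · rintro ⟨g, hg⟩
    rw [← cancel_epi (R.cochainComplexXIso (-(0 : ℕ)) 0 rfl).hom, ← hg, hX.eq_of_src g 0,
      Limits.comp_zero, Limits.comp_zero]
  · rintro rfl
    exact ⟨0, by simp⟩

variable {k : Type*} [CommRing k] [Linear k C]

/-- Classes of cocycles in a projective resolution, as a linear map to `Ext`. -/
noncomputable def extMkLinear (Y : C) (q : ℕ) :
    LinearMap.ker (Linear.leftComp k Y (R.complex.d (q + 1) q)) →ₗ[k] Ext X Y q where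
  toFun f := R.extMk f.1 (q + 1) rfl f.2
  map_add' f g := (R.add_extMk f.1 g.1 (q + 1) rfl f.2 g.2).symm
  map_smul' r f := by
    rw [RingHom.id_apply, Ext.smul_eq_comp_mk₀]
    refine Eq.trans ?_ (R.extMk_comp_mk₀ f.1 (q + 1) rfl f.2 (r • 𝟙 Y)).symm
    congr 1
    rw [Linear.comp_smul, Category.comp_id]
    rfl

theorem extMkLinear_surjective (Y : C) (q : ℕ) :
    Function.Surjective (R.extMkLinear (k := k) Y q) := by
  intro x
  obtain ⟨f, hf, rfl⟩ := R.extMk_surjective x (q + 1) rfl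
  exact ⟨⟨f, hf⟩, rfl⟩

end CategoryTheory.ProjectiveResolution

namespace GroupCohomologyClass

open groupCohomology

variable {k G : Type u} [CommRing k] [Group G] (V : Rep.{u} k G) (q : ℕ)

/-- Inhomogeneous cochains as morphisms out of the bar resolution. -/
noncomputable def cochainsEquiv :
    ((Fin q → G) → V) ≃ₗ[k] ((Rep.barResolution k G).complex.X q ⟶ V) :=
  (Rep.freeLiftLEquiv k G (Fin q → G) V).symm

theorem d_comp_cochainsEquiv (f : (Fin q → G) → V) :
    (Rep.barResolution k G).complex.d (q + 1) q ≫ cochainsEquiv V q f =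
      cochainsEquiv V (q + 1) (inhomogeneousCochains.d V q f) := by
  rw [inhomogeneousCochains.d_eq]
  exact ((Rep.freeLiftLEquiv k G (Fin (q + 1) → G) V).symm_apply_apply _).symm

/-- The class in `Ext` of a cocycle, as a linear map. -/
noncomputable def ofCocycleLinear :
    cocycles V q →ₗ[k] Abelian.Ext (Rep.trivial k G k) V q :=
  (Rep.barResolution k G).extMkLinear V q ∘ₗ
    ((cochainsEquiv V q).toLinearMap ∘ₗ (iCocycles V q).hom).codRestrict _ (bar_d_comp V q)

theorem ofCocycleLinear_surjective : Function.Surjective (ofCocycleLinear V q) := by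
  intro x
  obtain ⟨⟨f, hf⟩, rfl⟩ := (Rep.barResolution k G).extMkLinear_surjective (k := k) V q x
  obtain ⟨f, rfl⟩ := (cochainsEquiv V q).surjective f
  have hf' : inhomogeneousCochains.d V q f = 0 := by
    rw [LinearMap.mem_ker, Linear.leftComp_apply, d_comp_cochainsEquiv,
      LinearEquiv.map_eq_zero_iff] at hf
    exact hf
  refine ⟨cocyclesMk f hf', congrArg ((Rep.barResolution k G).extMkLinear (k := k) V q)
    (Subtype.ext ?_)⟩
  exact congrArg (cochainsEquiv V q) (iCocycles_mk f hf')

/-- A cocycle has trivial class if and only if it is a coboundary.  For `q = 0` the predecessor `p`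
is `0` and the differential is zero. -/
theorem π_eq_zero_iff (p : ℕ) (hp : (ComplexShape.up ℕ).prev q = p) (z : cocycles V q) :
    groupCohomology.π V q z = 0 ↔ ∃ g : (groupCohomology.inhomogeneousCochains V).X p,
      (groupCohomology.inhomogeneousCochains V).d p q g = iCocycles V q z := by
  have hex : (ShortComplex.mk (toCocycles V p q) (groupCohomology.π V q)
      ((groupCohomology.inhomogeneousCochains V).toCycles_comp_homologyπ p q)).Exact :=
    ShortComplex.exact_of_g_is_cokernel _
      ((groupCohomology.inhomogeneousCochains V).homologyIsCokernel p q hp)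
  have hinj : Function.Injective (iCocycles V q) :=
    (ModuleCat.mono_iff_injective (iCocycles V q)).1 inferInstance
  have hd : ∀ g, iCocycles V q (toCocycles V p q g) =
      (groupCohomology.inhomogeneousCochains V).d p q g := fun g =>
    congrArg (fun f => f.hom g) ((groupCohomology.inhomogeneousCochains V).toCycles_i p q)
  rw [ShortComplex.ShortExact.moduleCat_exact_iff_function_exact] at hex
  refine (hex z).trans (exists_congr fun g => ?_)
  rw [← hd]
  exact hinj.eq_iff.symm

theorem ofCocycleLinear_eq_zero_iff (z : cocycles V q) :
    ofCocycleLinear V q z = 0 ↔ groupCohomology.π V q z = 0 := by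
  cases q with
  | zero =>
    rw [π_eq_zero_iff V 0 0 (by simp)]
    refine ((Rep.barResolution k G).extMk_zero_degree_eq_zero_iff _ (bar_d_comp V 0 z)).trans ?_
    refine ((cochainsEquiv V 0).map_eq_zero_iff).trans ?_
    rw [(groupCohomology.inhomogeneousCochains V).shape 0 0 (by simp)]
    exact ⟨fun h => ⟨0, h.symm⟩, fun ⟨_, h⟩ => h.symm⟩
  | succ q =>
    rw [π_eq_zero_iff V (q + 1) q (by simp), groupCohomology.inhomogeneousCochains.d_def]
    refine ((Rep.barResolution k G).extMk_eq_zero_iff _ (q + 2) rfl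
      (bar_d_comp V (q + 1) z) q rfl).trans ?_
    rw [(cochainsEquiv V q).symm.exists_congr_left]
    refine exists_congr fun g => ?_
    change _ ≫ cochainsEquiv V q g = cochainsEquiv V (q + 1) (iCocycles V (q + 1) z) ↔ _
    rw [d_comp_cochainsEquiv]
    exact (cochainsEquiv V (q + 1)).injective.eq_iff

theorem π_surjective : Function.Surjective (groupCohomology.π V q) :=
  (ModuleCat.epi_iff_surjective _).1
    (inferInstanceAs (Epi ((groupCohomology.inhomogeneousCochains V).homologyπ q)))

/-- Group cohomology as `Ext`, by means of the bar resolution. -/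
noncomputable def extEquiv :
    groupCohomology V q ≃ₗ[k] Abelian.Ext (Rep.trivial k G k) V q :=
  have hker : LinearMap.ker (groupCohomology.π V q).hom = LinearMap.ker (ofCocycleLinear V q) :=
    Submodule.ext fun z => (ofCocycleLinear_eq_zero_iff V q z).symm
  ((groupCohomology.π V q).hom.quotKerEquivOfSurjective (π_surjective V q)).symm ≪≫ₗ
    Submodule.quotEquivOfEq _ _ hker ≪≫ₗ
      (ofCocycleLinear V q).quotKerEquivOfSurjective (ofCocycleLinear_surjective V q)

theorem extEquiv_π (z : cocycles V q) :
    extEquiv V q (groupCohomology.π V q z) = ofCocycle V q z := by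
  have h : ((groupCohomology.π V q).hom.quotKerEquivOfSurjective (π_surjective V q)).symm
      (groupCohomology.π V q z) = Submodule.Quotient.mk z := by
    rw [LinearEquiv.symm_apply_eq]
    rfl
  rw [extEquiv, LinearEquiv.trans_apply, LinearEquiv.trans_apply, h]
  rfl

end GroupCohomologyClass

/-! ### Linearity and bijectivity of restriction -/

section Restriction

open Abelian

variable {k : Type u} [CommRing k] {A : Type u} [Ring A] [Algebra k A] (ε : A →ₐ[k] k)
  {G : Type u} [Group G] (φ : G →* A)

open scoped ModuleCat.Algebra in
instance AugmentedAlgebra.toRep_linear : (toRep (k := k) φ).Linear k where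
  map_smul _ _ := rfl

theorem AugmentedAlgebra.restrict_add (hφ : ∀ g, ε (φ g) = 1) (q : ℕ) (x y : Cohomology ε q) :
    restrict ε φ hφ q (x + y) = restrict ε φ hφ q x + restrict ε φ hφ q y := by
  rw [restrict, Ext.mapExactFunctor_add, Ext.add_comp, Ext.comp_add]
  rfl

open scoped ModuleCat.Algebra in
theorem AugmentedAlgebra.restrict_smul (hφ : ∀ g, ε (φ g) = 1) (q : ℕ) (r : k)
    (x : Cohomology ε q) : restrict ε φ hφ q (r • x) = r • restrict ε φ hφ q x := by
  have h := (toRep (k := k) φ).mapExactFunctor_smul (trivialModule ε) (trivialModule ε) q k r x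
  have h' : restrict ε φ hφ q (r • x) = (Ext.mk₀ (toRepTrivial ε φ hφ).inv).comp
      ((r • x.mapExactFunctor (toRep (k := k) φ)).comp
        (Ext.mk₀ (toRepTrivial ε φ hφ).hom) (add_zero q)) (zero_add q) := by
    rw [← h]
    rfl
  rw [h', Ext.smul_comp, Ext.comp_smul]
  rfl

theorem CategoryTheory.Abelian.Ext.bijective_conj {C : Type*} [Category C] [Abelian C] [HasExt C]
    {X X' Y Y' : C} (i : X' ≅ X) (j : Y ≅ Y') (q : ℕ) : Function.Bijective fun x : Ext X Y q =>
      (Ext.mk₀ i.hom).comp (x.comp (Ext.mk₀ j.hom) (add_zero q)) (zero_add q) := by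
  refine Function.bijective_iff_has_inverse.2 ⟨fun x =>
    (Ext.mk₀ i.inv).comp (x.comp (Ext.mk₀ j.inv) (add_zero q)) (zero_add q), fun x => ?_,
    fun x => ?_⟩
  · simp
  · simp

theorem AugmentedAlgebra.restrict_bijective (hφ : ∀ g, ε (φ g) = 1) (q : ℕ)
    (h : Function.Bijective
      ((toRep (k := k) φ).mapExtAddHom (trivialModule ε) (trivialModule ε) q)) :
    Function.Bijective (restrict ε φ hφ q) :=
  (Ext.bijective_conj (toRepTrivial ε φ hφ).symm (toRepTrivial ε φ hφ) q).comp h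

end Restriction

end

/-- For every commutative ring `k`, every `δ : k` and all `q ≤ n - 1`, there is a `k`-linear
isomorphism `Ext_{P_n(δ)}^q(𝟙, 𝟙) ≅ H^q(Σ_n, 𝟙)`, and it is the canonical one: under the usual
identification of group cohomology classes with elements of `Ext` it is restriction along
`k[Σ_n] → P_n(δ)`. -/
theorem mainTheorem3 {k : Type u} [CommRing k] (δ : k) (n q : ℕ) (hq : q + 1 ≤ n) :
    ∃ e : PartitionAlgebra.Cohomology δ n q ≃ₗ[k]
        groupCohomology (Rep.trivial k (SymmetricGroup.{u} n) k) q,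
      ∀ z : groupCohomology.cocycles (Rep.trivial k (SymmetricGroup.{u} n) k) q,
        PartitionAlgebra.restrict δ n q
            (e.symm (groupCohomology.π (Rep.trivial k (SymmetricGroup.{u} n) k) q z)) =
          GroupCohomologyClass.ofCocycle (Rep.trivial k (SymmetricGroup.{u} n) k) q z := by
  let r : PartitionAlgebra.Cohomology δ n q →ₗ[k] CategoryTheory.Abelian.Ext
      (Rep.trivial k (SymmetricGroup.{u} n) k) (Rep.trivial k (SymmetricGroup.{u} n) k) q :=
    { toFun := PartitionAlgebra.restrict δ n q
      map_add' := AugmentedAlgebra.restrict_add _ _ _ q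
      map_smul' := AugmentedAlgebra.restrict_smul _ _ _ q }
  have hr : Function.Bijective r := AugmentedAlgebra.restrict_bijective _ _ _ q
    (PartitionAlgebra.mapExt_toRep_bijective δ hq (PartitionAlgebra.isInflated_trivialModule δ))
  refine ⟨LinearEquiv.ofBijective r hr ≪≫ₗ (GroupCohomologyClass.extEquiv _ q).symm, fun z => ?_⟩
  rw [LinearEquiv.trans_symm, LinearEquiv.symm_symm, LinearEquiv.trans_apply,
    GroupCohomologyClass.extEquiv_π]
  exact (LinearEquiv.ofBijective r hr).apply_symm_apply _
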